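/- Let $m$ be Lebesgue measure on $[0,1]$. For a measurable function $x:[0,1]\to\mathbb R$ let $x^*(t)=\inf\{s\ge 0 : m(\{u:|x(u)|>s\})\le t\}$, $t>0$, be its non-increasing rearrangement. A rearrangement-invariant (r.i.) space is a real Banach space $(E,\|\cdot\|_E)$ of Lebesgue measurable real-valued functions on $[0,1]$ (with identification $m$-a.e.) such that, for all $y\in E$ and all measurable $x$ on $[0,1]$: if $|x|\le |y|$ a.e., then $x\in E$ and $\|x\|_E\le\|y\|_E$; and if $x^*=y^*$, then $x\in E$ and $\|x\|_E=\|y\|_E$. The space $E$ has the Fatou property if, whenever $(f_n)\subseteq E$ and $f$ is measurable with $f_n\to f$ a.e. and $\sup_n\|f_n\|_E<\infty$, then $f\in E$ and $\|f\|_E\le\liminf_n\|f_n\|_E$. It satisfies an upper $2$-estimate if there is a constant $C>0$ such that $\big\|\sum_{j=1}^n x_j\big\|_E\le C\big(\sum_{j=1}^n\|x_j\|_E^2\big)^{1/2}$ for every finite sequence $(x_j)_{j=1}^n$ of pairwise disjoint elements of $E$. For $p\ge 1$, a bounded sequence $(x_n)\subseteq E$ is called a $p$-BS-sequence if $\sup_{m\ge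 1} m^{-1/p}\big\|\sum_{k=1}^m y_k\big\|_E<\infty$ for every subsequence $(y_k)$ of $(x_n)$. Let $\Gamma_{\rm i}(E)$ be the set of all real $p\ge 1$ such that every weakly null sequence in $E$ of independent random variables on $([0,1],m)$ has a subsequence which is a $p$-BS-sequence, and let $\Gamma_{\rm iid}(E)$ be the set of all real $p\ge 1$ such that every weakly null sequence in $E$ of independent identically distributed random variables on $([0,1],m)$ has a subsequence which is a $p$-BS-sequence. Theorem. If $E$ is a separable r.i. space with the Fatou property which satisfies an upper $2$-estimate, then $\Gamma_{\rm iid}(E)=\Gamma_{\rm i}(E)$. -/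

import Mathlib

open MeasureTheory Filter Topology

/-- Real-valued Lebesgue measurable functions on `[0,1]`, identified almost everywhere. -/
abbrev MeasFun01 : Type := unitInterval →ₘ[(volume : Measure unitInterval)] ℝ

/-- The non-increasing right-continuous rearrangement
`x*(t) = inf {s ≥ 0 : m {u : |x u| > s} ≤ t}`, meant for `t > 0`. -/
noncomputable def rearrangement (x : MeasFun01) (t : ℝ) : ℝ :=
  sInf {s : ℝ | 0 ≤ s ∧ (volume : Measure unitInterval) {u | s < |x u|} ≤ ENNReal.ofReal t}

section RISpaces

variable {E : Type*} [NormedAddCommGroup E] [NormedSpace ℝ E]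

/-- The Banach space `E`, realized through the injective linear map `ι` as a space of (classes of)
measurable functions on `[0,1]`, is a rearrangement-invariant space. -/
structure IsRISpace (ι : E →ₗ[ℝ] MeasFun01) : Prop where
  complete : CompleteSpace E
  injective : Function.Injective ι
  ideal : ∀ (y : E) (x : MeasFun01), |x| ≤ |ι y| → ∃ z : E, ι z = x ∧ ‖z‖ ≤ ‖y‖
  rearrangement_invariant : ∀ (y : E) (x : MeasFun01),
    (∀ t : ℝ, 0 < t → rearrangement x t = rearrangement (ι y) t) → ∃ z : E, ι z = x ∧ ‖z‖ = ‖y‖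

/-- The Fatou property: an a.e. limit `f` of a norm-bounded sequence of elements `f n` of the space
belongs to the space, with `‖f‖ ≤ liminf ‖f n‖`. -/
def HasFatouProperty (ι : E →ₗ[ℝ] MeasFun01) : Prop :=
  ∀ (f : ℕ → E) (g : MeasFun01),
    (∀ᵐ u ∂(volume : Measure unitInterval), Tendsto (fun n => ι (f n) u) atTop (𝓝 (g u))) →
    BddAbove (Set.range fun n => ‖f n‖) →
    ∃ z : E, ι z = g ∧ ‖z‖ ≤ liminf (fun n => ‖f n‖) atTop

/-- The upper `2`-estimate; `x` and `y` are disjoint when `|x| ⊓ |y| = 0`. -/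
def SatisfiesUpperTwoEstimate (ι : E →ₗ[ℝ] MeasFun01) : Prop :=
  ∃ C : ℝ, 0 < C ∧ ∀ (n : ℕ) (x : Fin n → E),
    (∀ i j, i ≠ j → |ι (x i)| ⊓ |ι (x j)| = 0) →
    ‖∑ i, x i‖ ≤ C * Real.sqrt (∑ i, ‖x i‖ ^ 2)

/-- Weak convergence to zero. -/
def IsWeaklyNull (x : ℕ → E) : Prop :=
  ∀ φ : StrongDual ℝ E, Tendsto (fun n => φ (x n)) atTop (𝓝 0)

/-- `x` is a `p`-BS-sequence: it is bounded and, for each of its subsequences `y`,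
`sup_m m^(-1/p) ‖y_1 + ⋯ + y_m‖ < ∞`. -/
def IsBSSequence (p : ℝ) (x : ℕ → E) : Prop :=
  BddAbove (Set.range fun n => ‖x n‖) ∧
  ∀ σ : ℕ → ℕ, StrictMono σ →
    ∃ C : ℝ, ∀ m : ℕ, 1 ≤ m → (m : ℝ) ^ (-(1 / p)) * ‖∑ k ∈ Finset.range m, x (σ k)‖ ≤ C

/-- The set of all `p ≥ 1` such that each weakly null sequence with the property `P` contains
a `p`-BS-sequence as a subsequence. -/
def bsIndexSet (P : (ℕ → E) → Prop) : Set ℝ :=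
  {p : ℝ | 1 ≤ p ∧ ∀ x : ℕ → E, IsWeaklyNull x → P x →
    ∃ τ : ℕ → ℕ, StrictMono τ ∧ IsBSSequence p (x ∘ τ)}

/-- The members of the sequence are independent random variables on `[0,1]`. -/
def IsIndepSeq (ι : E →ₗ[ℝ] MeasFun01) (x : ℕ → E) : Prop :=
  ProbabilityTheory.iIndepFun (fun n => (ι (x n) : unitInterval → ℝ))
    (volume : Measure unitInterval)

/-- The members of the sequence are identically distributed random variables on `[0,1]`. -/
def IsIdentDistribSeq (ι : E →ₗ[ℝ] MeasFun01) (x : ℕ → E) : Prop :=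
  ∀ n k, ProbabilityTheory.IdentDistrib (ι (x n) : unitInterval → ℝ) (ι (x k))
    (volume : Measure unitInterval) (volume : Measure unitInterval)

/-- The Banach–Saks index set `Γ_i(E)`. -/
def gammaI (ι : E →ₗ[ℝ] MeasFun01) : Set ℝ :=
  bsIndexSet (IsIndepSeq ι)

/-- The Banach–Saks index set `Γ_iid(E)`. -/
def gammaIID (ι : E →ₗ[ℝ] MeasFun01) : Set ℝ :=
  bsIndexSet fun x => IsIndepSeq ι x ∧ IsIdentDistribSeq ι x

end RISpaces

/-! Only the passage from i.i.d. to independent sequences has content. Let `p` lie in `gammaIID ι`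
and let `x` be weakly null and independent. Then `x` is bounded in `L¹`, hence tight, and Helly's
theorem gives a subsequence whose quantile functions `q n` converge a.e. to some `q₀`. With
independent uniform `U n`, the partial sums of that subsequence have the law of those of `q n ∘ U
n`, so by rearrangement invariance the norms agree. Split `q n ∘ U n = q₀ ∘ U n + d n ∘ U n`, where
`d n = q n - q₀`.

The remainder is norm bounded and tends to zero in measure. Absolute continuity of the norm (from
separability and Fatou) makes a subsequence disjoint up to summable errors, so the upper 2-estimate
bounds its partial sums by `C √m` (`exists_subseq_sum_le_sqrt`). The same bound forces `q₀` to have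
mean zero. A law of large numbers in norm (`NormLE.eventually_average`) then makes the copies `q₀ ∘
U n` weakly null, and the hypothesis on `p` applies to them.

Rademacher sums grow at least like `√m` in `L¹`, hence in `E`, so `p ≤ 2` when `E` is nonzero
(`le_two_of_mem_gammaIID`). Thus `√m ≤ m^(1/p)` and the remainder is harmless. -/

/-! ### Norm bounds for pointwise functions representing elements of the space. -/

section NormCalculus

open ProbabilityTheory unitInterval

variable {E : Type*} [NormedAddCommGroup E] [NormedSpace ℝ E]

/-- The function `f` represents an element of the space of norm at most `c`. -/
def NormLE (ι : E →ₗ[ℝ] MeasFun01) (f : I → ℝ) (c : ℝ) : Prop :=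
  ∃ z : E, (ι z : I → ℝ) =ᵐ[volume] f ∧ ‖z‖ ≤ c

variable {ι : E →ₗ[ℝ] MeasFun01} {f g : I → ℝ} {c d : ℝ}

lemma normLE_coe (ι : E →ₗ[ℝ] MeasFun01) (z : E) : NormLE ι (ι z) ‖z‖ :=
  ⟨z, ae_eq_refl _, le_rfl⟩

namespace NormLE

lemma aestronglyMeasurable (h : NormLE ι f c) : AEStronglyMeasurable f volume := by
  obtain ⟨z, hz, -⟩ := h
  exact (ι z).aestronglyMeasurable.congr hz

lemma aemeasurable (h : NormLE ι f c) : AEMeasurable f volume :=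
  h.aestronglyMeasurable.aemeasurable

lemma nonneg (h : NormLE ι f c) : 0 ≤ c := by
  obtain ⟨z, -, hz⟩ := h
  exact (norm_nonneg z).trans hz

lemma mono (h : NormLE ι f c) (hcd : c ≤ d) : NormLE ι f d := by
  obtain ⟨z, hz, hz'⟩ := h
  exact ⟨z, hz, hz'.trans hcd⟩

lemma congr (h : NormLE ι f c) (hfg : f =ᵐ[volume] g) : NormLE ι g c := by
  obtain ⟨z, hz, hz'⟩ := h
  exact ⟨z, hz.trans hfg, hz'⟩

lemma zero (hc : 0 ≤ c) : NormLE ι (fun _ => 0) c :=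
  ⟨0, by rw [map_zero]; exact AEEqFun.coeFn_zero, by simpa using hc⟩

lemma add (hf : NormLE ι f c) (hg : NormLE ι g d) : NormLE ι (fun u => f u + g u) (c + d) := by
  obtain ⟨y, hy, hy'⟩ := hf
  obtain ⟨z, hz, hz'⟩ := hg
  refine ⟨y + z, ?_, (norm_add_le y z).trans (add_le_add hy' hz')⟩
  rw [map_add]
  filter_upwards [AEEqFun.coeFn_add (ι y) (ι z), hy, hz] with u h1 h2 h3
  simp [h1, h2, h3]

lemma const_mul (hf : NormLE ι f c) (a : ℝ) : NormLE ι (fun u => a * f u) (|a| * c) := by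
  obtain ⟨y, hy, hy'⟩ := hf
  refine ⟨a • y, ?_, ?_⟩
  · rw [map_smul]
    filter_upwards [AEEqFun.coeFn_smul a (ι y), hy] with u h1 h2
    simp [h1, h2]
  · rw [norm_smul, Real.norm_eq_abs]
    gcongr

lemma neg (hf : NormLE ι f c) : NormLE ι (fun u => - f u) c := by
  simpa using hf.const_mul (-1)

lemma sub (hf : NormLE ι f c) (hg : NormLE ι g d) : NormLE ι (fun u => f u - g u) (c + d) := by
  simpa [sub_eq_add_neg] using hf.add hg.neg

lemma sum {f : ℕ → I → ℝ} {c : ℕ → ℝ} {s : Finset ℕ} (h : ∀ k ∈ s, NormLE ι (f k) (c k)) :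
    NormLE ι (fun u => ∑ k ∈ s, f k u) (∑ k ∈ s, c k) := by
  induction s using Finset.cons_induction with
  | empty => simpa using zero le_rfl
  | cons a s ha ih =>
    simp only [Finset.sum_cons]
    exact (h a (by simp)).add (ih fun k hk => h k (by simp [hk]))

lemma of_abs_le (hE : IsRISpace ι) (hg : NormLE ι g c) (hf : AEStronglyMeasurable f volume)
    (hfg : ∀ᵐ u, |f u| ≤ |g u|) : NormLE ι f c := by
  obtain ⟨y, hy, hy'⟩ := hg
  obtain ⟨z, hz, hz'⟩ := hE.ideal y (AEEqFun.mk f hf) (by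
    rw [← AEEqFun.coeFn_le]
    filter_upwards [AEEqFun.coeFn_abs (AEEqFun.mk f hf), AEEqFun.coeFn_abs (ι y), hy, hfg,
      AEEqFun.coeFn_mk f hf] with u h1 h2 h3 h4 h5
    rwa [h1, h2, h3, h5])
  exact ⟨z, by rw [hz]; exact AEEqFun.coeFn_mk f hf, hz'.trans hy'⟩

lemma indicator (hE : IsRISpace ι) (hf : NormLE ι f c) {s : Set I}
    (hs : NullMeasurableSet s volume) : NormLE ι (s.indicator f) c := by
  refine hf.of_abs_le hE (hf.aestronglyMeasurable.indicator₀ hs) (ae_of_all _ fun u => ?_)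
  simpa using norm_indicator_le_norm_self f u

end NormLE

lemma rearrangement_congr {x y : MeasFun01} {f g : I → ℝ} (hx : (x : I → ℝ) =ᵐ[volume] f)
    (hy : (y : I → ℝ) =ᵐ[volume] g) (h : IdentDistrib f g volume volume) (t : ℝ) :
    rearrangement x t = rearrangement y t := by
  have key : ∀ s : ℝ, volume {u | s < |x u|} = volume {u | s < |y u|} := by
    intro s
    have h1 : volume {u | s < |x u|} = volume (f ⁻¹' {r | s < |r|}) := by
      apply measure_congr
      filter_upwards [hx] with u hu
      exact congrArg (fun r => s < |r|) hu
    have h2 : volume {u | s < |y u|} = volume (g ⁻¹' {r | s < |r|}) := by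
      apply measure_congr
      filter_upwards [hy] with u hu
      exact congrArg (fun r => s < |r|) hu
    rw [h1, h2]
    exact h.measure_mem_eq (measurableSet_lt measurable_const measurable_id.abs)
  simp only [rearrangement, key]

namespace NormLE

lemma of_identDistrib (hE : IsRISpace ι) (hg : NormLE ι g c)
    (h : IdentDistrib f g volume volume) : NormLE ι f c := by
  obtain ⟨y, hy, hy'⟩ := hg
  have hf : AEStronglyMeasurable f volume := h.aemeasurable_fst.aestronglyMeasurable
  obtain ⟨z, hz, hz'⟩ := hE.rearrangement_invariant y (AEEqFun.mk f hf)
    fun t _ => rearrangement_congr (AEEqFun.coeFn_mk f hf) hy h t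
  exact ⟨z, by rw [hz]; exact AEEqFun.coeFn_mk f hf, hz'.trans_le hy'⟩

lemma of_tendsto (hF : HasFatouProperty ι) {f : ℕ → I → ℝ} (hf : ∀ n, NormLE ι (f n) c)
    (h : ∀ᵐ u, Tendsto (fun n => f n u) atTop (𝓝 (g u))) : NormLE ι g c := by
  choose z hz hz' using hf
  have hg : AEStronglyMeasurable g volume :=
    aestronglyMeasurable_of_tendsto_ae atTop
      (fun n => (ι (z n)).aestronglyMeasurable.congr (hz n)) h
  obtain ⟨w, hw, hw'⟩ := hF z (AEEqFun.mk g hg) (by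
    filter_upwards [h, ae_all_iff.2 hz, AEEqFun.coeFn_mk g hg] with u h1 h2 h3
    simpa only [h2, h3] using h1) ⟨c, by rintro _ ⟨n, rfl⟩; exact hz' n⟩
  refine ⟨w, by rw [hw]; exact AEEqFun.coeFn_mk g hg, hw'.trans ?_⟩
  refine liminf_le_of_frequently_le (Frequently.of_forall hz') ?_
  exact isBoundedUnder_of ⟨0, fun n => norm_nonneg _⟩

/-- The upper `2`-estimate for functions that are pairwise disjoint almost everywhere. -/
lemma exists_sum_of_disjoint (hU : SatisfiesUpperTwoEstimate ι) :
    ∃ C : ℝ, 0 < C ∧ ∀ (f : ℕ → I → ℝ) (c : ℝ) (m : ℕ), (∀ k, NormLE ι (f k) c) →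
      (∀ i j, i ≠ j → ∀ᵐ u, f i u = 0 ∨ f j u = 0) →
      NormLE ι (fun u => ∑ k ∈ Finset.range m, f k u) (C * (Real.sqrt m * c)) := by
  obtain ⟨C, hC, h⟩ := hU
  refine ⟨C, hC, fun f c m hf hd => ?_⟩
  choose z hz hz' using hf
  have hc : 0 ≤ c := (norm_nonneg _).trans (hz' 0)
  refine ⟨∑ k : Fin m, z k, ?_, (h m (fun k => z k) ?_).trans ?_⟩
  · rw [map_sum]
    have h1 : ∀ s : Finset (Fin m),
        ((∑ k ∈ s, ι (z k) : MeasFun01) : I → ℝ) =ᵐ[volume] fun u => ∑ k ∈ s, f k u := by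
      intro s
      induction s using Finset.cons_induction with
      | empty => simp only [Finset.sum_empty]; exact AEEqFun.coeFn_zero
      | cons a s ha ih =>
        simp only [Finset.sum_cons]
        filter_upwards [AEEqFun.coeFn_add (ι (z a)) (∑ k ∈ s, ι (z k)), ih, hz a] with u h1 h2 h3
        simp [h1, h2, h3]
    filter_upwards [h1 Finset.univ] with u hu
    rw [hu, Finset.sum_range]
  · intro i j hij
    apply AEEqFun.ext
    filter_upwards [AEEqFun.coeFn_inf |ι (z i)| |ι (z j)|, AEEqFun.coeFn_abs (ι (z i)),
      AEEqFun.coeFn_abs (ι (z j)), hz i, hz j, hd i j (by simpa [Fin.ext_iff] using hij),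
      (AEEqFun.coeFn_zero : ((0 : MeasFun01) : I → ℝ) =ᵐ[volume] 0)]
      with u h1 h2 h3 h4 h5 h6 h7
    rw [h1, h2, h3, h4, h5, h7]
    rcases h6 with h6 | h6 <;> simp [h6]
  · refine mul_le_mul_of_nonneg_left ?_ hC.le
    rw [Real.sqrt_le_left (by positivity), mul_pow, Real.sq_sqrt (by positivity)]
    calc ∑ i : Fin m, ‖z i‖ ^ 2 ≤ ∑ _i : Fin m, c ^ 2 := by
          gcongr with i
          exact hz' i
      _ = m * c ^ 2 := by simp

end NormLE

lemma norm_le_of_normLE (hE : IsRISpace ι) {z : E} (h : NormLE ι (ι z) c) : ‖z‖ ≤ c := by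
  obtain ⟨y, hy, hy'⟩ := h
  rwa [← hE.injective (AEEqFun.ext hy)]

lemma coeFn_sum_ae (ι : E →ₗ[ℝ] MeasFun01) (x : ℕ → E) (s : Finset ℕ) :
    (ι (∑ k ∈ s, x k) : I → ℝ) =ᵐ[volume] fun u => ∑ k ∈ s, ι (x k) u := by
  induction s using Finset.cons_induction with
  | empty => simp only [Finset.sum_empty, map_zero]; exact AEEqFun.coeFn_zero
  | cons a s ha ih =>
    simp only [Finset.sum_cons, map_add]
    filter_upwards [AEEqFun.coeFn_add (ι (x a)) (ι (∑ k ∈ s, x k)), ih] with u h1 h2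
    rw [h1, Pi.add_apply, h2]

end NormCalculus

/-! ### Independent copies, and the embedding of the space into `L¹`. -/

section UniformSequences

open ProbabilityTheory unitInterval

/-- A sequence of independent, uniformly distributed random variables on `[0,1]`. -/
structure IsUniformSeq (U : ℕ → I → I) : Prop where
  measurePreserving : ∀ n, MeasurePreserving (U n) volume volume
  indep : iIndepFun U volume

/-- Lebesgue measure on `[0,1]` can be pushed forward to the infinite product measure; the
coordinates of the transporting map are the required variables. -/
lemma exists_isUniformSeq : ∃ U : ℕ → I → I, IsUniformSeq U := by
  obtain ⟨T, hT, hT'⟩ :=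
    Measure.exists_measurable_map_eq (Measure.infinitePi fun _ : ℕ => (volume : Measure I))
  have hmp : MeasurePreserving T volume (Measure.infinitePi fun _ : ℕ => (volume : Measure I)) :=
    ⟨hT, hT'⟩
  have hU : ∀ n, MeasurePreserving (fun u => T u n) (volume : Measure I) volume := fun n =>
    (measurePreserving_eval_infinitePi (fun _ : ℕ => (volume : Measure I)) n).comp hmp
  refine ⟨fun n u => T u n, hU, ?_⟩
  rw [iIndepFun_iff_map_fun_eq_infinitePi_map fun n => (hU n).measurable]
  simp only [(hU _).map_eq]
  exact hT'

namespace IsUniformSeq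

variable {U : ℕ → I → I}

lemma identDistrib (hU : IsUniformSeq U) {f : I → ℝ} (hf : AEMeasurable f volume) (n : ℕ) :
    IdentDistrib (fun u => f (U n u)) f volume volume := by
  have hn := hU.measurePreserving n
  refine ⟨hf.comp_quasiMeasurePreserving hn.quasiMeasurePreserving, hf, ?_⟩
  have := AEMeasurable.map_map_of_aemeasurable (μ := volume) (f := U n) (g := f)
    (by rwa [hn.map_eq]) hn.measurable.aemeasurable
  rw [hn.map_eq] at this
  exact this.symm

lemma comp_indep (hU : IsUniformSeq U) {f : ℕ → I → ℝ} (hf : ∀ n, AEMeasurable (f n) volume) :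
    iIndepFun (fun n u => f n (U n u)) volume :=
  hU.indep.comp₀ f (fun n => (hU.measurePreserving n).measurable.aemeasurable)
    fun n => by rw [(hU.measurePreserving n).map_eq]; exact hf n

lemma precomp (hU : IsUniformSeq U) {τ : ℕ → ℕ} (hτ : Function.Injective τ) :
    IsUniformSeq (U ∘ τ) :=
  ⟨fun n => hU.measurePreserving (τ n), iIndepFun.precomp (g := τ) hτ hU.indep⟩

lemma ae_tendsto_average (hU : IsUniformSeq U) {f : I → ℝ} (hf : Integrable f volume) :
    ∀ᵐ u, Tendsto (fun m : ℕ => (∑ k ∈ Finset.range m, f (U k u)) / m) atTop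
      (𝓝 (∫ u, f u)) := by
  have h0 := hU.identDistrib hf.aemeasurable
  have h := strong_law_ae_real (fun n u => f (U n u)) ((h0 0).integrable_iff.2 hf)
    (fun i j hij => (hU.comp_indep fun _ => hf.aemeasurable).indepFun hij)
    fun i => (h0 i).trans (h0 0).symm
  rwa [(h0 0).integral_eq] at h

end IsUniformSeq

variable {E : Type*} [NormedAddCommGroup E] [NormedSpace ℝ E]
variable {ι : E →ₗ[ℝ] MeasFun01} {f : I → ℝ} {c : ℝ} {U : ℕ → I → I}

namespace NormLE

lemma comp_uniform (hE : IsRISpace ι) (hU : IsUniformSeq U) (hf : NormLE ι f c) (n : ℕ) :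
    NormLE ι (fun u => f (U n u)) c :=
  hf.of_identDistrib hE (hU.identDistrib hf.aemeasurable n)

lemma average {f : ℕ → I → ℝ} (hf : ∀ n, NormLE ι (f n) c) (m : ℕ) :
    NormLE ι (fun u => (∑ k ∈ Finset.range m, f k u) / m) c := by
  have h := (NormLE.sum (s := Finset.range m) (c := fun _ => c)
    fun k _ => hf k).const_mul (1 / (m : ℝ))
  refine (h.mono ?_).congr (ae_of_all _ fun u => ?_)
  · have hc := (hf 0).nonneg
    rcases Nat.eq_zero_or_pos m with rfl | hm
    · simpa using hc
    · have hm' : (0 : ℝ) < m := by exact_mod_cast hm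
      rw [Finset.sum_const, Finset.card_range, nsmul_eq_mul, abs_of_pos (by positivity)]
      field_simp
      exact le_rfl
  · simp only
    ring

/-- Averages of independent copies of `f` keep the bound `c` and converge a.e. to the mean by the
strong law; the Fatou property passes the bound to the limit. -/
lemma const_integral (hE : IsRISpace ι) (hF : HasFatouProperty ι) (hf : NormLE ι f c)
    (hi : Integrable f volume) : NormLE ι (fun _ => ∫ u, f u) c := by
  obtain ⟨U, hU⟩ := exists_isUniformSeq
  exact NormLE.of_tendsto hF (fun m => NormLE.average (fun n => hf.comp_uniform hE hU n) m)
    (hU.ae_tendsto_average hi)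

end NormLE

lemma exists_normLE_one [Nontrivial E] (hE : IsRISpace ι) (hF : HasFatouProperty ι) :
    ∃ c, NormLE ι (fun _ => 1) c := by
  obtain ⟨z, hz⟩ := exists_ne (0 : E)
  have hm : AEStronglyMeasurable (fun u => min |ι z u| 1) volume :=
    ((ι z).aestronglyMeasurable.norm.inf aestronglyMeasurable_const)
  have hb : ∀ u, |min |ι z u| 1| ≤ 1 := fun u => by
    rw [abs_of_nonneg (by positivity)]; exact min_le_right _ _
  have hg : NormLE ι (fun u => min |ι z u| 1) ‖z‖ := by
    refine (normLE_coe ι z).of_abs_le hE hm (ae_of_all _ fun u => ?_)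
    rw [abs_of_nonneg (by positivity)]
    exact min_le_left _ _
  have hi : Integrable (fun u => min |ι z u| 1) volume :=
    Integrable.of_bound hm 1 (ae_of_all _ hb)
  have hne : ∫ u, min |ι z u| 1 ≠ 0 := by
    intro h0
    rw [integral_eq_zero_iff_of_nonneg (fun u => by positivity) hi] at h0
    apply hz
    apply hE.injective
    rw [map_zero]
    apply AEEqFun.ext
    filter_upwards [h0, (AEEqFun.coeFn_zero : ((0 : MeasFun01) : I → ℝ) =ᵐ[volume] 0)] with u h1 h2
    rw [h2]
    by_contra h
    have : 0 < |ι z u| := abs_pos.2 h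
    have h3 : 0 < min |ι z u| 1 := lt_min this one_pos
    exact h3.ne' h1
  have h := (hg.const_integral hE hF hi).const_mul (∫ u, min |ι z u| 1)⁻¹
  exact ⟨_, h.congr (ae_of_all _ fun u => inv_mul_cancel₀ hne)⟩

/-- Replacing `|f|` by its mean does not increase the norm, and the norm of a constant is
proportional to its modulus. Integrability of `f` is not yet known, so this is applied to the
truncations `min |f| n`, followed by Fatou's lemma. -/
lemma exists_lintegral_le [Nontrivial E] (hE : IsRISpace ι) (hF : HasFatouProperty ι) :
    ∃ K : ℝ, 0 ≤ K ∧ ∀ (f : I → ℝ) (c : ℝ), NormLE ι f c → ∫⁻ u, ‖f u‖ₑ ≤ ENNReal.ofReal (K * c) := by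
  obtain ⟨c₁, z₁, hz₁, -⟩ := exists_normLE_one hE hF
  have hconst : ∀ (a c : ℝ), NormLE ι (fun _ => a) c → |a| * ‖z₁‖ ≤ c := by
    intro a c h
    have : NormLE ι (ι (a • z₁)) c := by
      refine h.congr ?_
      rw [map_smul]
      filter_upwards [AEEqFun.coeFn_smul a (ι z₁), hz₁] with u h1 h2
      simp [h1, h2]
    simpa [norm_smul] using norm_le_of_normLE hE this
  have hpos : 0 < ‖z₁‖ := by
    rw [norm_pos_iff]
    rintro rfl
    rw [map_zero] at hz₁
    have h := hz₁.symm.trans AEEqFun.coeFn_zero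
    obtain ⟨u, hu⟩ := h.exists
    simp at hu
  refine ⟨‖z₁‖⁻¹, by positivity, fun f c hf => ?_⟩
  have hm : ∀ n : ℕ, AEStronglyMeasurable (fun u => min |f u| n) volume := fun n =>
    hf.aestronglyMeasurable.norm.inf aestronglyMeasurable_const
  have hint : ∀ n : ℕ, ∫⁻ u, ‖min |f u| n‖ₑ ≤ ENNReal.ofReal (‖z₁‖⁻¹ * c) := by
    intro n
    have hb : ∀ u, |min |f u| n| ≤ n := fun u => by
      rw [abs_of_nonneg (by positivity)]; exact min_le_right _ _
    have hi : Integrable (fun u => min |f u| n) volume :=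
      Integrable.of_bound (hm n) n (ae_of_all _ hb)
    have hg : NormLE ι (fun u => min |f u| n) c := by
      refine hf.of_abs_le hE (hm n) (ae_of_all _ fun u => ?_)
      rw [abs_of_nonneg (by positivity)]
      exact min_le_left _ _
    have h := hconst _ _ (hg.const_integral hE hF hi)
    rw [← ofReal_integral_norm_eq_lintegral_enorm hi]
    apply ENNReal.ofReal_le_ofReal
    have h2 : ∫ u, ‖min |f u| n‖ = ∫ u, min |f u| n :=
      integral_congr_ae (ae_of_all _ fun u => Real.norm_of_nonneg (by positivity))
    rw [h2, inv_mul_eq_div, le_div_iff₀ hpos]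
    exact (mul_le_mul_of_nonneg_right (le_abs_self _) hpos.le).trans h
  have hlim : ∀ u, liminf (fun n : ℕ => ‖min |f u| n‖ₑ) atTop = ‖f u‖ₑ := by
    intro u
    apply Tendsto.liminf_eq
    apply tendsto_const_nhds.congr'
    obtain ⟨N, hN⟩ := exists_nat_ge |f u|
    filter_upwards [eventually_ge_atTop N] with n hn
    rw [min_eq_left (hN.trans (by exact_mod_cast hn)), Real.enorm_abs]
  calc ∫⁻ u, ‖f u‖ₑ = ∫⁻ u, liminf (fun n : ℕ => ‖min |f u| n‖ₑ) atTop := by simp_rw [hlim]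
    _ ≤ liminf (fun n : ℕ => ∫⁻ u, ‖min |f u| n‖ₑ) atTop :=
        lintegral_liminf_le' fun n => (hm n).enorm
    _ ≤ ENNReal.ofReal (‖z₁‖⁻¹ * c) :=
        liminf_le_of_frequently_le' (Frequently.of_forall hint)

lemma exists_integral_abs_le [Nontrivial E] (hE : IsRISpace ι) (hF : HasFatouProperty ι) :
    ∃ K : ℝ, 0 ≤ K ∧ ∀ (f : I → ℝ) (c : ℝ), NormLE ι f c →
      Integrable f volume ∧ ∫ u, |f u| ≤ K * c := by
  obtain ⟨K, hK, h⟩ := exists_lintegral_le hE hF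
  refine ⟨K, hK, fun f c hf => ?_⟩
  have hi : Integrable f volume :=
    ⟨hf.aestronglyMeasurable, (h f c hf).trans_lt ENNReal.ofReal_lt_top⟩
  refine ⟨hi, ?_⟩
  have := h f c hf
  rw [← ofReal_integral_norm_eq_lintegral_enorm hi,
    ENNReal.ofReal_le_ofReal_iff (mul_nonneg hK hf.nonneg)] at this
  exact this

end UniformSequences

/-! ### Absolute continuity of the norm and the law of large numbers in norm. -/

section OrderContinuity

open ProbabilityTheory unitInterval

variable {E : Type*} [NormedAddCommGroup E] [NormedSpace ℝ E]
variable {ι : E →ₗ[ℝ] MeasFun01} {f : I → ℝ} {c : ℝ} {U : ℕ → I → I}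

namespace NormLE

lemma indicator_mono (hE : IsRISpace ι) {s t : Set I} (hf : NormLE ι (t.indicator f) c)
    (hst : s ⊆ t) (hs : NullMeasurableSet s volume) : NormLE ι (s.indicator f) c := by
  have := hf.indicator hE hs
  rwa [Set.indicator_indicator, Set.inter_eq_left.2 hst] at this

/-- In a separable space the restrictions of an element to disjoint sets cannot all be large. -/
lemma exists_indicator_of_disjoint [TopologicalSpace.SeparableSpace E] (hE : IsRISpace ι)
    (hf : NormLE ι f c) {B : ℕ → Set I} (hB : ∀ n, NullMeasurableSet (B n) volume)
    (hd : Pairwise (Function.onFun Disjoint B)) {δ : ℝ} (hδ : 0 < δ) :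
    ∃ n, NormLE ι ((B n).indicator f) δ := by
  by_contra! hcon
  have hS : ∀ S : Set ℕ, NormLE ι ((⋃ n ∈ S, B n).indicator f) c := fun S =>
    hf.indicator hE (NullMeasurableSet.biUnion S.to_countable fun n _ => hB n)
  choose z hz _ using hS
  have hval : ∀ (S : Set ℕ) (n : ℕ) (u : I), u ∈ B n →
      (⋃ n ∈ S, B n).indicator f u = S.indicator (fun _ => f u) n := by
    intro S n u hu
    by_cases hn : n ∈ S
    · rw [Set.indicator_of_mem hn, Set.indicator_of_mem (Set.mem_biUnion hn hu)]
    · rw [Set.indicator_of_notMem hn, Set.indicator_of_notMem]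
      simp only [Set.mem_iUnion, not_exists]
      intro k hk huk
      have hkn : k ≠ n := fun h => hn (h ▸ hk)
      exact Set.disjoint_left.1 (hd hkn) huk hu
  -- On a block `B n` with `n` in exactly one of `S`, `T`, the difference equals `±f`. Hence there
  -- would be a `δ`-separated family indexed by all subsets of `ℕ`, contradicting separability.
  have hsep : ∀ S T : Set ℕ, S ≠ T → δ < ‖z S - z T‖ := by
    intro S T hST
    obtain ⟨n, hn⟩ : ∃ n, ¬ (n ∈ S ↔ n ∈ T) := by
      by_contra! h
      exact hST (Set.ext h)
    by_contra! hle
    apply hcon n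
    have h1 : NormLE ι (fun u => (⋃ n ∈ S, B n).indicator f u - (⋃ n ∈ T, B n).indicator f u)
        δ := by
      refine ⟨z S - z T, ?_, hle⟩
      rw [map_sub]
      filter_upwards [AEEqFun.coeFn_sub (ι (z S)) (ι (z T)), hz S, hz T] with u h1 h2 h3
      rw [h1, Pi.sub_apply, h2, h3]
    refine h1.of_abs_le hE (hf.aestronglyMeasurable.indicator₀ (hB n)) (ae_of_all _ fun u => ?_)
    by_cases hu : u ∈ B n
    · rw [hval S n u hu, hval T n u hu, Set.indicator_of_mem hu]
      by_cases h1 : n ∈ S <;> by_cases h2 : n ∈ T <;> simp_all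
    · simp [hu]
  have hcount : Countable (Set ℕ) := by
    refine Pairwise.countable_of_isOpen_disjoint (s := fun S => Metric.ball (z S) (δ / 2)) ?_
      (fun S => Metric.isOpen_ball) fun S => Metric.nonempty_ball.2 (by positivity)
    intro S T hST
    refine Metric.ball_disjoint_ball ?_
    rw [dist_eq_norm]
    linarith [hsep S T hST]
  obtain ⟨g, hg⟩ := hcount.exists_injective_nat
  exact Function.cantor_injective g hg

/-- Absolute continuity of the norm. -/
lemma exists_indicator_of_small [TopologicalSpace.SeparableSpace E] (hE : IsRISpace ι)
    (hF : HasFatouProperty ι) (hf : NormLE ι f c) {ε : ℝ} (hε : 0 < ε) :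
    ∃ η : ℝ, 0 < η ∧ ∀ B : Set I, NullMeasurableSet B volume → volume B ≤ ENNReal.ofReal η →
      NormLE ι (B.indicator f) ε := by
  by_contra! hcon
  choose B hB hBv hBn using fun n : ℕ => hcon ((1 / 2) ^ n) (by positivity)
  set C : ℕ → Set I := fun n => ⋃ k ≥ n, B k with hC
  have hCm : ∀ n, NullMeasurableSet (C n) volume := fun n =>
    NullMeasurableSet.biUnion (Set.to_countable _) fun k _ => hB k
  have hCanti : Antitone C := fun m n hmn =>
    Set.biUnion_subset_biUnion_left (show {k | n ≤ k} ⊆ {k | m ≤ k} from fun _ hk => hmn.trans hk)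
  have hBC : ∀ n, B n ⊆ C n := fun n => Set.subset_biUnion_of_mem (u := B) (le_refl n)
  have hCn : ∀ n, ¬ NormLE ι ((C n).indicator f) ε := fun n h =>
    hBn n (h.indicator_mono hE (hBC n) (hB n))
  have hsum : ∑' n, volume (B n) ≠ ⊤ := by
    refine ne_top_of_le_ne_top ?_ (ENNReal.tsum_le_tsum hBv)
    rw [← ENNReal.ofReal_tsum_of_nonneg (fun n => by positivity)
      (summable_geometric_of_lt_one (by norm_num) (by norm_num))]
    exact ENNReal.ofReal_ne_top
  -- Borel–Cantelli: the measures of the `B n` are summable.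
  have hae : ∀ᵐ u : I, ∀ᶠ n in atTop, u ∉ C n := by
    filter_upwards [ae_eventually_notMem hsum] with u hu
    obtain ⟨N, hN⟩ := eventually_atTop.1 hu
    filter_upwards [eventually_ge_atTop N] with n hn hun
    simp only [hC, Set.mem_iUnion] at hun
    obtain ⟨k, hk, huk⟩ := hun
    exact hN k (hn.trans hk) huk
  -- Otherwise Fatou, as `m → ∞`, would bound `f` on all of `C n` by `ε`. Iterating yields disjoint
  -- differences that all carry norm more than `ε`.
  have hstep : ∀ n, ∃ m, n < m ∧ ¬ NormLE ι ((C n \ C m).indicator f) ε := by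
    intro n
    by_contra! h
    apply hCn n
    refine NormLE.of_tendsto hF (f := fun k => (C n \ C (n + 1 + k)).indicator f)
      (fun k => h _ (by omega)) ?_
    filter_upwards [hae] with u hu
    apply tendsto_const_nhds.congr'
    have h2 := (tendsto_add_atTop_nat (n + 1)).eventually hu
    filter_upwards [h2] with k hk
    rw [add_comm] at hk
    by_cases hun : u ∈ C n
    · rw [Set.indicator_of_mem hun, Set.indicator_of_mem
        (show u ∈ C n \ C (n + 1 + k) from ⟨hun, hk⟩)]
    · rw [Set.indicator_of_notMem hun, Set.indicator_of_notMem fun (h : u ∈ C n \ C (n + 1 + k)) => hun h.1]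
  choose F hF1 hF2 using hstep
  set N : ℕ → ℕ := fun k => F^[k] 0 with hN
  have hNs : ∀ k, N (k + 1) = F (N k) := fun k => Function.iterate_succ_apply' F k 0
  have hNmono : StrictMono N := strictMono_nat_of_lt_succ fun k => by rw [hNs]; exact hF1 _
  obtain ⟨k, hk⟩ := hf.exists_indicator_of_disjoint hE (B := fun k => C (N k) \ C (N (k + 1)))
    (fun k => (hCm _).diff (hCm _)) (by
      have key : ∀ i j, i < j → Disjoint (C (N i) \ C (N (i + 1))) (C (N j) \ C (N (j + 1))) := by
        intro i j hij
        rw [Set.disjoint_left]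
        intro u hu hu'
        exact hu.2 (hCanti (hNmono.monotone (Nat.succ_le_of_lt hij)) hu'.1)
      intro i j hij
      rcases lt_or_gt_of_ne hij with h | h
      · exact key i j h
      · exact (key j i h).symm) hε
  rw [hNs] at hk
  exact hF2 _ hk

/-- Bounded convergence in the norm of the space. -/
lemma eventually_of_bounded [TopologicalSpace.SeparableSpace E] (hE : IsRISpace ι)
    (hF : HasFatouProperty ι) (h1 : NormLE ι (fun _ => 1) c) {h : ℕ → I → ℝ} {M : ℝ}
    (hm : ∀ n, AEStronglyMeasurable (h n) volume) (hb : ∀ n, ∀ᵐ u, |h n u| ≤ M)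
    (hlim : ∀ᵐ u, Tendsto (fun n => h n u) atTop (𝓝 0)) {ε : ℝ} (hε : 0 < ε) :
    ∀ᶠ n in atTop, NormLE ι (h n) ε := by
  have hc := h1.nonneg
  have hconst : ∀ a : ℝ, NormLE ι (fun _ => a) (|a| * c) := fun a => by
    simpa using h1.const_mul a
  obtain ⟨η, hη, hηB⟩ := (hconst M).exists_indicator_of_small hE hF (half_pos hε)
  set ε' := ε / (2 * (c + 1)) with hε'
  have hε'pos : 0 < ε' := by positivity
  have hmeas := ((tendstoInMeasure_of_tendsto_ae hm hlim) _
    (ENNReal.ofReal_pos.2 hε'pos)).eventually_lt_const (ENNReal.ofReal_pos.2 hη)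
  filter_upwards [hmeas] with n hn
  set B : Set I := {u | ENNReal.ofReal ε' ≤ edist (h n u) 0} with hB
  have hBm : NullMeasurableSet B volume :=
    nullMeasurableSet_le aemeasurable_const ((hm n).aemeasurable.edist aemeasurable_const)
  have hsum := (hconst ε').add (hηB B hBm hn.le)
  refine (hsum.of_abs_le hE (hm n) ?_).mono ?_
  · filter_upwards [hb n] with u hu
    have hM : 0 ≤ M := (abs_nonneg _).trans hu
    by_cases huB : u ∈ B
    · rw [Set.indicator_of_mem huB, abs_of_nonneg (a := ε' + M) (by linarith)]
      linarith
    · rw [Set.indicator_of_notMem huB, add_zero, abs_of_pos hε'pos]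
      have : edist (h n u) 0 < ENNReal.ofReal ε' := not_le.1 huB
      rw [edist_lt_ofReal, Real.dist_eq, sub_zero] at this
      exact this.le
  · rw [abs_of_pos hε'pos]
    have : ε' * c ≤ ε / 2 := by
      rw [hε', div_mul_eq_mul_div, div_le_div_iff₀ (by positivity) (by positivity)]
      nlinarith
    linarith

/-- The law of large numbers in the norm of the space. -/
lemma eventually_average [TopologicalSpace.SeparableSpace E] [Nontrivial E] (hE : IsRISpace ι)
    (hF : HasFatouProperty ι) (hU : IsUniformSeq U) (hf : NormLE ι f c) (h0 : ∫ u, f u = 0)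
    {ε : ℝ} (hε : 0 < ε) :
    ∀ᶠ m : ℕ in atTop, NormLE ι (fun u => (∑ k ∈ Finset.range m, f (U k u)) / m) ε := by
  obtain ⟨c₁, h1⟩ := exists_normLE_one hE hF
  obtain ⟨K, -, hK⟩ := exists_integral_abs_le hE hF
  have hfi := (hK f c hf).1
  have hε3 : 0 < ε / 3 := by positivity
  obtain ⟨η, hη, hηB⟩ := hf.exists_indicator_of_small hE hF hε3
  -- Markov's inequality fixes the truncation level. The large part of `f` costs `ε / 3`, its mean
  -- at most as much, and the centred averages of the bounded part are handled by bounded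
  -- convergence.
  obtain ⟨M, hM0, hM⟩ : ∃ M : ℝ, 0 < M ∧ volume {u | M ≤ |f u|} ≤ ENNReal.ofReal η := by
    set J := ∫ u, |f u| with hJ
    have hJ0 : 0 ≤ J := integral_nonneg fun u => abs_nonneg _
    refine ⟨(J + 1) / η, by positivity, ?_⟩
    have := mul_meas_ge_le_integral_of_nonneg (ae_of_all _ fun u => abs_nonneg (f u)) hfi.abs
      ((J + 1) / η)
    rw [← hJ] at this
    rw [← ofReal_measureReal]
    apply ENNReal.ofReal_le_ofReal
    rw [div_mul_eq_mul_div, div_le_iff₀ hη] at this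
    have h2 : 0 ≤ volume.real {u | (J + 1) / η ≤ |f u|} := measureReal_nonneg
    nlinarith
  set B : Set I := {u | M ≤ |f u|} with hB
  have hBm : NullMeasurableSet B volume :=
    nullMeasurableSet_le aemeasurable_const hf.aemeasurable.abs
  have hr := hηB B hBm hM
  have hbN := hf.indicator hE hBm.compl
  have hbi := (hK _ _ hbN).1
  have hri := (hK _ _ hr).1
  have hsplit : ∀ u, f u = B.indicator f u + Bᶜ.indicator f u := fun u => by
    have := Set.indicator_self_add_compl B f
    exact (congrFun this u).symm
  have hint : ∫ u, Bᶜ.indicator f u = - ∫ u, B.indicator f u := by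
    have : ∫ u, f u = ∫ u, (B.indicator f u + Bᶜ.indicator f u) :=
      integral_congr_ae (ae_of_all _ hsplit)
    rw [h0, integral_add hri hbi] at this
    linarith
  have hbb : ∀ u, |Bᶜ.indicator f u| ≤ M := by
    intro u
    by_cases hu : u ∈ B
    · simp [hu, hM0.le]
    · rw [Set.indicator_of_mem (by exact hu)]
      exact (not_le.1 hu).le
  set J := ∫ u, Bᶜ.indicator f u with hJ
  have hcN : NormLE ι (fun _ => J) (ε / 3) := by
    rw [hint]
    exact (hr.const_integral hE hF hri).neg
  have hev := NormLE.eventually_of_bounded hE hF h1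
    (h := fun m u => (∑ k ∈ Finset.range m, Bᶜ.indicator f (U k u)) / m - J) (M := M + |J|)
    (fun m => ((NormLE.average (fun n => hbN.comp_uniform hE hU n) m).sub hcN).aestronglyMeasurable)
    (fun m => ae_of_all _ fun u => by
      refine (abs_sub _ _).trans (add_le_add ?_ le_rfl)
      rw [abs_div, Nat.abs_cast]
      rcases Nat.eq_zero_or_pos m with rfl | hm
      · simpa using hM0.le
      · rw [div_le_iff₀ (by exact_mod_cast hm)]
        refine (Finset.abs_sum_le_sum_abs _ _).trans ?_
        refine (Finset.sum_le_sum fun k _ => hbb (U k u)).trans ?_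
        simp [mul_comm])
    (by
      filter_upwards [hU.ae_tendsto_average hbi] with u hu
      have := hu.sub_const J
      rwa [sub_self] at this) hε3
  filter_upwards [hev] with m hm
  refine (((NormLE.average (fun n => hr.comp_uniform hE hU n) m).add hm).add hcN).mono
    (by linarith) |>.congr (ae_of_all _ fun u => ?_)
  simp only
  rw [Finset.sum_congr rfl fun k _ => hsplit (U k u), Finset.sum_add_distrib]
  ring

end NormLE

/-- If `φ (x n) ≥ ε` held infinitely often, it would persist for averages along that subsequence,
which have arbitrarily small norm. -/
lemma isWeaklyNull_of_average {x : ℕ → E}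
    (h : ∀ τ : ℕ → ℕ, StrictMono τ → ∀ ε : ℝ, 0 < ε →
      ∃ m : ℕ, 1 ≤ m ∧ ‖∑ k ∈ Finset.range m, x (τ k)‖ ≤ ε * m) : IsWeaklyNull x := by
  have key : ∀ (φ : StrongDual ℝ E) (ε : ℝ), 0 < ε → ∀ᶠ n in atTop, φ (x n) < ε := by
    intro φ ε hε
    by_contra hcon
    obtain ⟨τ, hτ, hτ'⟩ := extraction_of_frequently_atTop
      (P := fun n => ¬ φ (x n) < ε) (not_eventually.1 hcon)
    obtain ⟨m, hm, hm'⟩ := h τ hτ (ε / (2 * (‖φ‖ + 1))) (by positivity)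
    have hm0 : (0 : ℝ) < m := by exact_mod_cast hm
    have h1 : (m : ℝ) * ε ≤ φ (∑ k ∈ Finset.range m, x (τ k)) := by
      rw [map_sum]
      calc (m : ℝ) * ε = ∑ k ∈ Finset.range m, ε := by simp
        _ ≤ _ := Finset.sum_le_sum fun k _ => not_lt.1 (hτ' k)
    have h2 := (le_abs_self _).trans (φ.le_opNorm (∑ k ∈ Finset.range m, x (τ k)))
    have h3 : ‖φ‖ * ‖∑ k ∈ Finset.range m, x (τ k)‖ ≤ ‖φ‖ * (ε / (2 * (‖φ‖ + 1)) * m) := by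
      gcongr
    have h4 : ‖φ‖ * (ε / (2 * (‖φ‖ + 1)) * m) ≤ ε / 2 * m := by
      rw [← mul_assoc]
      gcongr
      rw [mul_div_assoc', div_le_div_iff₀ (by positivity) (by positivity)]
      nlinarith [norm_nonneg φ]
    nlinarith
  intro φ
  rw [Metric.tendsto_atTop']
  intro ε hε
  have := (key φ ε hε).and (key (-φ) ε hε)
  obtain ⟨N, hN⟩ := eventually_atTop.1 this
  refine ⟨N, fun n hn => ?_⟩
  have h1 := hN n hn.le
  rw [Real.dist_eq, sub_zero, abs_lt]
  simp only [neg_apply] at h1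
  exact ⟨by linarith, h1.1⟩

/-- Independent copies of a mean zero element form a weakly null sequence. -/
lemma exists_iid_copies [TopologicalSpace.SeparableSpace E] [Nontrivial E] (hE : IsRISpace ι)
    (hF : HasFatouProperty ι) (hU : IsUniformSeq U) (hf : NormLE ι f c) (h0 : ∫ u, f u = 0) :
    ∃ g : ℕ → E, (∀ n, (ι (g n) : I → ℝ) =ᵐ[volume] fun u => f (U n u)) ∧ IsWeaklyNull g ∧
      IsIndepSeq ι g ∧ IsIdentDistribSeq ι g := by
  choose g hg _ using fun n => hf.comp_uniform hE hU n
  refine ⟨g, hg, isWeaklyNull_of_average fun τ hτ ε hε => ?_, ?_, fun n k => ?_⟩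
  · have hev := hf.eventually_average hE hF (hU.precomp hτ.injective) h0 hε
    obtain ⟨m, hm, hm1⟩ := (hev.and (eventually_ge_atTop 1)).exists
    refine ⟨m, hm1, norm_le_of_normLE hE ?_⟩
    have hm0 : (0 : ℝ) < m := by exact_mod_cast hm1
    refine ((hm.const_mul m).mono (by rw [Nat.abs_cast, mul_comm])).congr ?_
    filter_upwards [coeFn_sum_ae ι (fun k => g (τ k)) (Finset.range m),
      ae_all_iff.2 fun k => hg k] with u h1 h2
    rw [h1, mul_div_cancel₀ _ hm0.ne']
    exact Finset.sum_congr rfl fun k _ => (h2 (τ k)).symm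
  · exact (hU.comp_indep fun _ => hf.aemeasurable).congr fun n => (hg n).symm
  · have h1 : ∀ n, IdentDistrib (ι (g n) : I → ℝ) f volume volume := fun n =>
      (IdentDistrib.of_ae_eq (ι (g n)).aemeasurable (hg n)).trans
        (hU.identDistrib hf.aemeasurable n)
    exact (h1 n).trans (h1 k).symm

end OrderContinuity

/-! ### Lower bound for Rademacher sums, and `p ≤ 2`. -/

section Rademacher

open ProbabilityTheory unitInterval

/-- The characteristic function of the sum at `t` is `cos t ^ m` by independence; take expectations
in `|exp (i t S) - 1| ≤ |t| |S|`. -/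
lemma one_sub_cos_pow_le_integral_abs_sum {U : ℕ → I → I} (hU : IsUniformSeq U) {f : I → ℝ}
    (hfm : Measurable f) (hf : ∀ u, f u = 1 ∨ f u = -1) (h0 : ∫ u, f u = 0) (m : ℕ) (t : ℝ) :
    1 - Real.cos t ^ m ≤ |t| * ∫ u, |∑ k ∈ Finset.range m, f (U k u)| := by
  have hfi : Integrable f volume := Integrable.of_bound hfm.aestronglyMeasurable 1
    (ae_of_all _ fun u => by rcases hf u with h | h <;> simp [h])
  set S : I → ℝ := fun u => ∑ k ∈ Finset.range m, f (U k u) with hS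
  have hfU : ∀ k, Measurable fun u => f (U k u) := fun k =>
    hfm.comp (hU.measurePreserving k).measurable
  have hSm : Measurable S := Finset.measurable_sum _ fun k _ => hfU k
  have hSi : Integrable S volume := integrable_finsetSum _ fun k _ =>
    (hU.identDistrib hfm.aemeasurable k).integrable_iff.2 hfi
  have hchar : ∀ {g : I → ℝ}, Measurable g →
      charFun (volume.map g) t = ∫ u, Complex.exp (Complex.I * (t * g u : ℝ)) := by
    intro g hg
    rw [charFun_apply_real, integral_map hg.aemeasurable (by fun_prop)]
    refine integral_congr_ae (ae_of_all _ fun u => ?_)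
    simp only [Complex.ofReal_mul]
    ring_nf
  have h1 : charFun (volume.map f) t = Real.cos t := by
    rw [hchar hfm]
    have : ∀ u, Complex.exp (Complex.I * (t * f u : ℝ)) =
        Real.cos t + Complex.I * Real.sin t * (f u : ℝ) := by
      intro u
      rcases hf u with h | h
      · rw [h, mul_comm, Complex.exp_mul_I]
        simp
        ring
      · rw [h, mul_comm, Complex.exp_mul_I]
        simp
        ring
    rw [integral_congr_ae (ae_of_all _ this), integral_add (integrable_const _)
      (hfi.ofReal.const_mul _), integral_const_mul, integral_complex_ofReal (f := f), h0]
    simp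
  have h2 : charFun (volume.map S) t = (Real.cos t : ℂ) ^ m := by
    have hind := (hU.comp_indep (f := fun _ => f) fun _ => hfm.aemeasurable).restrict
      (Finset.range m)
    rw [hS, iIndepFun.charFun_map_fun_finsetSum_eq_prod (X := fun k u => f (U k u))
      (fun k _ => (hfU k).aemeasurable) hind, Finset.prod_apply]
    have : ∀ k, charFun (volume.map fun u => f (U k u)) t = Real.cos t := fun k => by
      rw [(hU.identDistrib hfm.aemeasurable k).map_eq, h1]
    simp only [this, Finset.prod_const, Finset.card_range]
  rw [hchar hSm] at h2
  have hbd : ∀ g : ℝ, ‖Complex.exp (Complex.I * (g : ℝ))‖ ≤ 1 := fun g => by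
    rw [mul_comm, Complex.norm_exp_ofReal_mul_I]
  have hEi : Integrable (fun u => Complex.exp (Complex.I * (t * S u : ℝ))) volume := by
    refine Integrable.of_bound (C := 1) ?_ (ae_of_all _ fun u => hbd _)
    exact Measurable.aestronglyMeasurable (by fun_prop)
  have h3 : ∫ u, (Complex.exp (Complex.I * (t * S u : ℝ)) - 1) = (Real.cos t : ℂ) ^ m - 1 := by
    rw [integral_sub hEi (integrable_const _), h2]
    simp
  have h4 : ‖(Real.cos t : ℂ) ^ m - 1‖ ≤ |t| * ∫ u, |S u| := by
    rw [← h3, ← integral_const_mul]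
    refine norm_integral_le_of_norm_le (hSi.abs.const_mul _) (ae_of_all _ fun u => ?_)
    refine Real.norm_exp_I_mul_ofReal_sub_one_le.trans ?_
    rw [Real.norm_eq_abs, abs_mul]
  have h5 : ‖(Real.cos t : ℂ) ^ m - 1‖ = |Real.cos t ^ m - 1| := by
    rw [← Complex.ofReal_pow, ← Complex.ofReal_one, ← Complex.ofReal_sub, Complex.norm_real,
      Real.norm_eq_abs]
  rw [h5] at h4
  linarith [neg_abs_le (Real.cos t ^ m - 1)]

/-- Sums of independent Rademacher variables have mean absolute value of order at least `√m`. -/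
lemma le_integral_abs_sum {U : ℕ → I → I} (hU : IsUniformSeq U) {f : I → ℝ}
    (hfm : Measurable f) (hf : ∀ u, f u = 1 ∨ f u = -1) (h0 : ∫ u, f u = 0) {m : ℕ}
    (hm : 1 ≤ m) :
    (1 - Real.exp (-(2 / Real.pi ^ 2))) * Real.sqrt m ≤
      ∫ u, |∑ k ∈ Finset.range m, f (U k u)| := by
  have hm0 : (0 : ℝ) < m := by exact_mod_cast hm
  have hsq : 0 < Real.sqrt m := Real.sqrt_pos.2 hm0
  have hsq1 : 1 ≤ Real.sqrt m := Real.one_le_sqrt.2 (by exact_mod_cast hm)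
  -- At this scale `cos t ^ m` stays below a constant less than `1`, while the factor `|t|` yields
  -- `√m`.
  set t := (Real.sqrt m)⁻¹ with ht
  have ht0 : 0 < t := by positivity
  have ht1 : t ≤ 1 := inv_le_one_of_one_le₀ hsq1
  have ht2 : t ^ 2 = 1 / m := by rw [ht, inv_pow, Real.sq_sqrt hm0.le, one_div]
  have hcos := Real.cos_le_one_sub_mul_cos_sq (x := t)
    (by rw [abs_of_pos ht0]; linarith [Real.pi_gt_three])
  have hcos0 : 0 ≤ Real.cos t := (Real.cos_pos_of_le_one (by rwa [abs_of_pos ht0])).le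
  have hle : Real.cos t ^ m ≤ Real.exp (-(2 / Real.pi ^ 2)) := by
    have h1 : Real.cos t ≤ Real.exp (-(2 / Real.pi ^ 2 * t ^ 2)) := by
      linarith [Real.add_one_le_exp (-(2 / Real.pi ^ 2 * t ^ 2))]
    calc Real.cos t ^ m ≤ Real.exp (-(2 / Real.pi ^ 2 * t ^ 2)) ^ m :=
          pow_le_pow_left₀ hcos0 h1 m
      _ = Real.exp (-(2 / Real.pi ^ 2)) := by
          rw [← Real.exp_nat_mul, ht2]
          congr 1
          field_simp
  have h := one_sub_cos_pow_le_integral_abs_sum hU hfm hf h0 m t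
  rw [abs_of_pos ht0, ht, inv_mul_eq_div, le_div_iff₀ hsq] at h
  refine le_trans ?_ h
  gcongr

lemma exists_rademacher : ∃ f : I → ℝ, Measurable f ∧ (∀ u, f u = 1 ∨ f u = -1) ∧
    ∫ u, f u = 0 := by
  set a : I := ⟨1 / 2, by norm_num, by norm_num⟩ with ha
  have hm : MeasurableSet (Set.Iic a) := measurableSet_Iic
  refine ⟨fun u => 2 * (Set.Iic a).indicator (fun _ => (1 : ℝ)) u - 1,
    ((measurable_const.indicator hm).const_mul 2).sub_const 1, fun u => ?_, ?_⟩
  · by_cases hu : u ∈ Set.Iic a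
    · left; simp [hu]; norm_num
    · right; simp only [Set.indicator_of_notMem hu]; norm_num
  · have hi : Integrable ((Set.Iic a).indicator fun _ => (1 : ℝ)) (volume : Measure I) :=
      (integrable_const _).indicator hm
    rw [integral_sub (hi.const_mul 2) (integrable_const _), integral_const_mul,
      integral_indicator hm, setIntegral_const, measureReal_def, unitInterval.volume_Iic]
    simp [ha]

variable {E : Type*} [NormedAddCommGroup E] [NormedSpace ℝ E]
variable {ι : E →ₗ[ℝ] MeasFun01}

lemma le_two_of_mem_gammaIID [TopologicalSpace.SeparableSpace E] [Nontrivial E]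
    (hE : IsRISpace ι) (hF : HasFatouProperty ι) {p : ℝ} (hp : p ∈ gammaIID ι) : p ≤ 2 := by
  by_contra! hp2
  obtain ⟨U, hU⟩ := exists_isUniformSeq
  obtain ⟨f, hfm, hf, h0⟩ := exists_rademacher
  obtain ⟨c₁, h1⟩ := exists_normLE_one hE hF
  obtain ⟨K, hK0, hK⟩ := exists_integral_abs_le hE hF
  have hfN : NormLE ι f c₁ := h1.of_abs_le hE hfm.aestronglyMeasurable
    (ae_of_all _ fun u => by rcases hf u with h | h <;> simp [h])
  obtain ⟨g, hg, hgw, hgi, hgd⟩ := exists_iid_copies hE hF hU hfN h0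
  obtain ⟨τ, hτ, -, hbs⟩ := hp.2 g hgw ⟨hgi, hgd⟩
  obtain ⟨C, hC⟩ := hbs id strictMono_id
  set e := 1 - Real.exp (-(2 / Real.pi ^ 2)) with he
  have he0 : 0 < e := by
    have : Real.exp (-(2 / Real.pi ^ 2)) < 1 := Real.exp_lt_one_iff.2 (by
      have := Real.pi_pos
      rw [neg_lt_zero]; positivity)
    linarith
  -- The lower bound `e √m` meets the upper bound `K C m^(1/p)`; for `p > 2` the right side tends to
  -- zero.
  have hmain : ∀ m : ℕ, 1 ≤ m → e ≤ K * C * (m : ℝ) ^ (-(1 / 2 - 1 / p)) := by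
    intro m hm
    have hm0 : (0 : ℝ) < m := by exact_mod_cast hm
    have hlow := le_integral_abs_sum (hU.precomp hτ.injective) hfm hf h0 hm
    have hS : NormLE ι (fun u => ∑ k ∈ Finset.range m, f ((U ∘ τ) k u))
        ‖∑ k ∈ Finset.range m, g (τ k)‖ := by
      refine (normLE_coe ι _).congr ?_
      filter_upwards [coeFn_sum_ae ι (fun k => g (τ k)) (Finset.range m),
        ae_all_iff.2 fun k => hg k] with u h1 h2
      rw [h1]
      exact Finset.sum_congr rfl fun k _ => h2 (τ k)
    have hup := (hK _ _ hS).2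
    have hbs := hC m hm
    simp only [Function.comp_apply, id_eq] at hbs
    rw [Real.rpow_neg hm0.le, inv_mul_eq_div, div_le_iff₀ (by positivity)] at hbs
    have h2 : e * Real.sqrt m ≤ K * (C * (m : ℝ) ^ (1 / p)) :=
      (hlow.trans hup).trans (mul_le_mul_of_nonneg_left hbs hK0)
    rw [neg_sub, Real.rpow_sub hm0, ← Real.sqrt_eq_rpow, ← mul_div_assoc,
      le_div_iff₀ (Real.sqrt_pos.2 hm0), mul_assoc]
    exact h2
  have hpos : 0 < 1 / 2 - 1 / p := by
    rw [sub_pos]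
    exact one_div_lt_one_div_of_lt two_pos hp2
  have hlim := ((tendsto_rpow_neg_atTop hpos).comp tendsto_natCast_atTop_atTop).const_mul (K * C)
  rw [mul_zero] at hlim
  have := ge_of_tendsto hlim (by
    filter_upwards [eventually_ge_atTop 1] with m hm
    exact hmain m hm)
  linarith

end Rademacher

/-! ### Quantile functions and Helly selection. -/

section Quantiles

open ProbabilityTheory unitInterval

/-- The quantile function of a probability measure on `ℝ`. -/
noncomputable def quantile (μ : Measure ℝ) (t : I) : EReal :=
  ⨅ (s : ℝ) (_ : (t : ℝ) ≤ cdf μ s), (s : EReal)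

variable (μ : Measure ℝ)

/-- Right continuity of the distribution function makes the infimum attained. -/
lemma quantile_le_iff (t : I) (s : ℝ) : quantile μ t ≤ s ↔ (t : ℝ) ≤ cdf μ s := by
  refine ⟨fun h => ?_, fun h => iInf₂_le s h⟩
  have hc : Tendsto (cdf μ) (𝓝[>] s) (𝓝 (cdf μ s)) :=
    ((cdf μ).right_continuous s).tendsto.mono_left (nhdsWithin_mono s Set.Ioi_subset_Ici_self)
  refine ge_of_tendsto hc ?_
  filter_upwards [self_mem_nhdsWithin] with s' hs'
  have h1 : quantile μ t < s' := h.trans_lt (by exact_mod_cast hs')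
  simp only [quantile, iInf_lt_iff] at h1
  obtain ⟨r, hr, hrs⟩ := h1
  exact hr.trans (monotone_cdf μ (by exact_mod_cast hrs.le))

lemma monotone_quantile : Monotone (quantile μ) := by
  intro t t' htt
  refine le_iInf₂ fun s hs => (quantile_le_iff μ t s).2 (le_trans ?_ hs)
  exact_mod_cast htt

lemma quantile_ne_top {t : I} (ht : t < 1) : quantile μ t ≠ ⊤ := by
  have ht' : (t : ℝ) < 1 := ht
  obtain ⟨s, hs⟩ := ((tendsto_cdf_atTop μ).eventually_const_lt ht').exists
  exact (((quantile_le_iff μ t s).2 hs.le).trans_lt (EReal.coe_lt_top s)).ne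

lemma quantile_ne_bot {t : I} (ht : 0 < t) : quantile μ t ≠ ⊥ := by
  have ht' : 0 < (t : ℝ) := ht
  obtain ⟨s, hs⟩ := ((tendsto_cdf_atBot μ).eventually_lt_const ht').exists
  intro h
  have := (quantile_le_iff μ t s).1 (by rw [h]; exact bot_le)
  exact absurd hs (not_lt.2 this)

lemma measurable_toReal_quantile : Measurable fun t => (quantile μ t).toReal :=
  (monotone_quantile μ).measurable.ereal_toReal

lemma ae_mem_Ioo : ∀ᵐ t : I, 0 < t ∧ t < 1 := by
  have h0 : ∀ᵐ t : I, t ≠ 0 := by simp [ae_iff]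
  have h1 : ∀ᵐ t : I, t ≠ 1 := by simp [ae_iff]
  filter_upwards [h0, h1] with t h0 h1
  exact ⟨unitInterval.pos_iff_ne_zero.2 h0, unitInterval.lt_one_iff_ne_one.2 h1⟩

lemma map_toReal_quantile [IsProbabilityMeasure μ] :
    Measure.map (fun t => (quantile μ t).toReal) volume = μ := by
  have hm := measurable_toReal_quantile μ
  have := Measure.isProbabilityMeasure_map (μ := (volume : Measure I)) hm.aemeasurable
  refine Measure.ext_of_Iic _ _ fun s => ?_
  rw [Measure.map_apply hm measurableSet_Iic, ← ofReal_cdf μ s]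
  have h1 : (fun t => (quantile μ t).toReal) ⁻¹' Set.Iic s =ᵐ[volume]
      Set.Iic (⟨cdf μ s, cdf_nonneg μ s, cdf_le_one μ s⟩ : I) := by
    filter_upwards [ae_mem_Ioo] with t ht
    apply propext
    change (quantile μ t).toReal ≤ s ↔ (t : ℝ) ≤ cdf μ s
    rw [← quantile_le_iff, ← EReal.coe_le_coe_iff,
      EReal.coe_toReal (quantile_ne_top μ ht.2) (quantile_ne_bot μ ht.1)]
  rw [measure_congr h1, unitInterval.volume_Iic]

/-- Helly's selection theorem for monotone functions with extended real values. -/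
lemma exists_subseq_tendsto_of_monotone {q : ℕ → I → EReal} (hq : ∀ n, Monotone (q n)) :
    ∃ φ : ℕ → ℕ, StrictMono φ ∧ ∀ᵐ t : I, ∃ L, Tendsto (fun n => q (φ n) t) atTop (𝓝 L) := by
  obtain ⟨D, hDc, hDd⟩ := TopologicalSpace.exists_countable_dense I
  have := hDc.to_subtype
  obtain ⟨L, φ, hφ, hL⟩ := CompactSpace.tendsto_subseq fun n (d : D) => q n d
  rw [tendsto_pi_nhds] at hL
  refine ⟨φ, hφ, ?_⟩
  set a : I → EReal := fun t => liminf (fun n => q (φ n) t) atTop with ha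
  have hmono : Monotone a := fun s t hst =>
    liminf_le_liminf (Eventually.of_forall fun n => hq (φ n) hst)
  have hcross : ∀ s t : I, s < t → limsup (fun n => q (φ n) s) atTop ≤ a t := by
    intro s t hst
    obtain ⟨d, hdD, hsd, hdt⟩ := hDd.exists_between hst
    have hd : Tendsto (fun n => q (φ n) d) atTop (𝓝 (L ⟨d, hdD⟩)) := hL ⟨d, hdD⟩
    calc limsup (fun n => q (φ n) s) atTop ≤ limsup (fun n => q (φ n) d) atTop :=
          limsup_le_limsup (Eventually.of_forall fun n => hq (φ n) hsd.le)
      _ = liminf (fun n => q (φ n) d) atTop := by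
          rw [hd.limsup_eq, hd.liminf_eq]
      _ ≤ a t := liminf_le_liminf (Eventually.of_forall fun n => hq (φ n) hdt.le)
  have hcont : ∀ᵐ t : I, ContinuousAt a t := hmono.countable_not_continuousAt.measure_zero volume
  filter_upwards [hcont, ae_mem_Ioo] with t ht ht01
  -- At a continuity point of the lower limit `a`, the upper limit at `t` is squeezed by `a s` as
  -- `s` decreases to `t`.
  have hne : (𝓝[>] t).NeBot := nhdsGT_neBot_of_exists_gt ⟨1, ht01.2⟩
  have hle : limsup (fun n => q (φ n) t) atTop ≤ a t := by
    refine ge_of_tendsto (ht.tendsto.mono_left nhdsWithin_le_nhds : Tendsto a (𝓝[>] t) _) ?_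
    filter_upwards [self_mem_nhdsWithin] with s hs
    exact hcross t s hs
  exact ⟨a t, tendsto_of_le_liminf_of_limsup_le le_rfl hle⟩

lemma measureReal_le_of_integral_abs_le {x : I → ℝ} {M R : ℝ} (hx : Integrable x volume)
    (hM : ∫ u, |x u| ≤ M) (hR : 0 < R) : volume.real {u | R ≤ |x u|} ≤ M / R := by
  rw [le_div_iff₀ hR, mul_comm]
  exact (mul_meas_ge_le_integral_of_nonneg (ae_of_all _ fun u => abs_nonneg (x u)) hx.abs R).trans hM

/-- Markov's inequality bounds both tails beyond `R` by `M / R`. The bound depends only on `M`, so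
limits of quantiles remain finite inside `(0,1)`. -/
lemma abs_quantile_le {x : I → ℝ} {M R : ℝ} (hx : Integrable x volume) (hM : ∫ u, |x u| ≤ M)
    (hR : 0 < R) {t : I} (h0 : M / R < t) (h1 : M / R ≤ 1 - t) :
    ((-R : ℝ) : EReal) ≤ quantile (volume.map x) t ∧ quantile (volume.map x) t ≤ (R : ℝ) := by
  have := Measure.isProbabilityMeasure_map (μ := (volume : Measure I)) hx.aemeasurable
  have hbd := measureReal_le_of_integral_abs_le hx hM hR
  constructor
  · by_contra! h
    have h2 := (quantile_le_iff _ t _).1 h.le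
    rw [ProbabilityTheory.cdf_eq_real, map_measureReal_apply_of_aemeasurable hx.aemeasurable measurableSet_Iic] at h2
    have h3 : volume.real (x ⁻¹' Set.Iic (-R)) ≤ volume.real {u | R ≤ |x u|} := by
      refine measureReal_mono fun u (hu : x u ≤ -R) => ?_
      exact (show R ≤ -x u by linarith).trans (neg_le_abs _)
    linarith
  · rw [quantile_le_iff, ProbabilityTheory.cdf_eq_real,
      map_measureReal_apply_of_aemeasurable hx.aemeasurable measurableSet_Iic]
    have h3 : (1 : ℝ) ≤ volume.real (x ⁻¹' Set.Iic R) + volume.real {u | R ≤ |x u|} := by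
      refine le_trans ?_ (measureReal_union_le _ _)
      have : x ⁻¹' Set.Iic R ∪ {u | R ≤ |x u|} = Set.univ := by
        ext u
        simp only [Set.mem_union, Set.mem_preimage, Set.mem_Iic, Set.mem_ofPred_eq, Set.mem_univ,
          iff_true]
        rcases le_total (x u) R with h | h
        · exact Or.inl h
        · exact Or.inr (h.trans (le_abs_self _))
      rw [this]
      simp
    linarith

/-- A sequence bounded in `L¹` has a subsequence with copies converging almost everywhere. -/
lemma exists_identDistrib_tendsto {x : ℕ → I → ℝ} {M : ℝ} (hx : ∀ n, Integrable (x n) volume)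
    (hM : ∀ n, ∫ u, |x n u| ≤ M) :
    ∃ (φ : ℕ → ℕ) (q : ℕ → I → ℝ) (q₀ : I → ℝ), StrictMono φ ∧
      (∀ n, IdentDistrib (q n) (x (φ n)) volume volume) ∧
      ∀ᵐ t, Tendsto (fun n => q n t) atTop (𝓝 (q₀ t)) := by
  have hprob : ∀ n, IsProbabilityMeasure (volume.map (x n)) := fun n =>
    Measure.isProbabilityMeasure_map (hx n).aemeasurable
  obtain ⟨φ, hφ, hlim⟩ := exists_subseq_tendsto_of_monotone
    fun n => monotone_quantile (volume.map (x n))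
  refine ⟨φ, fun n t => (quantile (volume.map (x (φ n))) t).toReal, fun t =>
    (limUnder atTop fun n => quantile (volume.map (x (φ n))) t).toReal, hφ, fun n => ?_, ?_⟩
  · exact ⟨(measurable_toReal_quantile _).aemeasurable, (hx _).aemeasurable,
      map_toReal_quantile _⟩
  · filter_upwards [hlim, ae_mem_Ioo] with t ht ht01
    have hL := tendsto_nhds_limUnder ht
    set L := limUnder atTop fun n => quantile (volume.map (x (φ n))) t
    have h0 : 0 < (t : ℝ) := ht01.1
    have h1 : (t : ℝ) < 1 := ht01.2
    have hM0 : 0 ≤ M := (integral_nonneg fun u => abs_nonneg _).trans (hM 0)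
    set δ := min (t : ℝ) (1 - t) with hδ
    have hδ0 : 0 < δ := lt_min h0 (by linarith)
    have hR : 0 < (M + 1) / δ := by positivity
    have hMR : M / ((M + 1) / δ) < δ := by
      rw [div_div_eq_mul_div, div_lt_iff₀ (by positivity)]
      nlinarith
    have hb := fun n => abs_quantile_le (hx (φ n)) (hM _) hR
      (hMR.trans_le (min_le_left _ _)) (hMR.le.trans (min_le_right _ _))
    have hlo := ge_of_tendsto' hL fun n => (hb n).1
    have hhi := le_of_tendsto' hL fun n => (hb n).2
    exact (EReal.tendsto_toReal (ne_top_of_le_ne_top (EReal.coe_ne_top _) hhi)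
      (ne_bot_of_le_ne_bot (EReal.coe_ne_bot _) hlo)).comp hL

end Quantiles

/-! ### Subsequence splitting and the upper 2-estimate. -/

section AlmostDisjoint

open ProbabilityTheory unitInterval

variable {E : Type*} [NormedAddCommGroup E] [NormedSpace ℝ E]
variable {ι : E →ₗ[ℝ] MeasFun01}

/-- A bounded sequence tending to zero in measure has a subsequence that is a perturbation of a
sequence of disjoint functions: the sets `A i` carry its large parts. -/
lemma exists_subseq_almost_disjoint [TopologicalSpace.SeparableSpace E] (hE : IsRISpace ι)
    (hF : HasFatouProperty ι) {D : ℕ → I → ℝ} {M : ℝ} (hD : ∀ n, NormLE ι (D n) M)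
    (hlim : ∀ δ : ℝ, 0 < δ → Tendsto (fun n => volume {u | δ ≤ |D n u|}) atTop (𝓝 0)) :
    ∃ (ψ : ℕ → ℕ) (A : ℕ → Set I), StrictMono ψ ∧ (∀ i, NullMeasurableSet (A i) volume) ∧
      (∀ i, ∀ u ∉ A i, |D (ψ i) u| ≤ (1 / 2) ^ i) ∧
      ∀ i, NormLE ι ((⋃ k, A (i + 1 + k)).indicator (D (ψ i))) ((1 / 2) ^ i) := by
  choose η hη hηB using fun n => (hD n).exists_indicator_of_small hE hF
    (show (0 : ℝ) < (1 / 2) ^ n by positivity)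
  have hstep : ∀ n, ∃ k, n < k ∧ ∀ j ≤ n,
      volume {u | (1 / 2) ^ n ≤ |D k u|} ≤ ENNReal.ofReal ((1 / 2) ^ n * η j) := by
    intro n
    have h1 : ∀ j ∈ Finset.range (n + 1), ∀ᶠ k in atTop,
        volume {u | (1 / 2) ^ n ≤ |D k u|} < ENNReal.ofReal ((1 / 2) ^ n * η j) := fun j _ =>
      (hlim _ (by positivity)).eventually_lt_const
        (ENNReal.ofReal_pos.2 (mul_pos (by positivity) (hη j)))
    obtain ⟨k, hk, hkn⟩ :=
      (((Filter.eventually_all_finset _).2 h1).and (eventually_gt_atTop n)).exists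
    exact ⟨k, hkn, fun j hj => (hk j (Finset.mem_range.2 (by omega))).le⟩
  choose F hF1 hF2 using hstep
  set N : ℕ → ℕ := fun k => F^[k] 0 with hN
  have hNs : ∀ k, N (k + 1) = F (N k) := fun k => Function.iterate_succ_apply' F k 0
  have hNmono : StrictMono N := strictMono_nat_of_lt_succ fun k => by rw [hNs]; exact hF1 _
  have hpow : ∀ i, ((1 : ℝ) / 2) ^ N i ≤ (1 / 2) ^ i := fun i =>
    pow_le_pow_of_le_one (by norm_num) (by norm_num) hNmono.le_apply
  -- The level uses `N i`, the index uses `N (i + 1)`: the latter was chosen after the former, small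
  -- against every `η j` with `j ≤ N i`. Hence the later sets together have measure at most `η (N (i
  -- + 1))`.
  set A : ℕ → Set I := fun i => {u | (1 / 2) ^ N i ≤ |D (N (i + 1)) u|} with hA
  have hAm : ∀ i, NullMeasurableSet (A i) volume := fun i =>
    nullMeasurableSet_le aemeasurable_const (hD _).aemeasurable.abs
  refine ⟨fun i => N (i + 1), A, fun i j hij => hNmono (by omega), hAm, fun i u hu => ?_,
    fun i => ?_⟩
  · exact (not_le.1 hu).le.trans (hpow i)
  · refine (hηB (N (i + 1)) _ (NullMeasurableSet.iUnion fun k => hAm _) ?_).mono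
      ((hpow (i + 1)).trans (pow_le_pow_of_le_one (by norm_num) (by norm_num) (by omega)))
    have hvol : ∀ k, volume (A (i + 1 + k)) ≤
        ENNReal.ofReal ((1 / 2) ^ (k + 1) * η (N (i + 1))) := by
      intro k
      have h1 := hF2 (N (i + 1 + k)) (N (i + 1)) (hNmono.monotone (by omega))
      rw [← hNs] at h1
      refine h1.trans (ENNReal.ofReal_le_ofReal (mul_le_mul_of_nonneg_right ?_ (hη _).le))
      exact (hpow _).trans (pow_le_pow_of_le_one (by norm_num) (by norm_num) (by omega))
    have hs : HasSum (fun k : ℕ => ((1 : ℝ) / 2) ^ (k + 1) * η (N (i + 1))) (η (N (i + 1))) := by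
      have h := (hasSum_geometric_two.mul_right (1 / 2)).mul_right (η (N (i + 1)))
      simpa [pow_succ] using h
    calc volume (⋃ k, A (i + 1 + k)) ≤ ∑' k, volume (A (i + 1 + k)) := measure_iUnion_le _
      _ ≤ ∑' k, ENNReal.ofReal ((1 / 2) ^ (k + 1) * η (N (i + 1))) := ENNReal.tsum_le_tsum hvol
      _ = ENNReal.ofReal (η (N (i + 1))) := by
          rw [← ENNReal.ofReal_tsum_of_nonneg
            (fun k => mul_nonneg (by positivity) (hη _).le) hs.summable, hs.tsum_eq]

lemma sum_pow_strictMono_le {τ : ℕ → ℕ} (hτ : StrictMono τ) (m : ℕ) :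
    ∑ k ∈ Finset.range m, ((1 : ℝ) / 2) ^ τ k ≤ 2 := by
  calc ∑ k ∈ Finset.range m, ((1 : ℝ) / 2) ^ τ k ≤ ∑ k ∈ Finset.range m, ((1 : ℝ) / 2) ^ k :=
        Finset.sum_le_sum fun k _ =>
          pow_le_pow_of_le_one (by norm_num) (by norm_num) hτ.le_apply
    _ ≤ 2 := sum_geometric_two_le m

/-- Under an upper `2`-estimate a bounded sequence tending to zero in measure has a subsequence
all of whose subsequences have partial sums of order `√m`. -/
lemma exists_subseq_sum_le_sqrt [TopologicalSpace.SeparableSpace E] [Nontrivial E]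
    (hE : IsRISpace ι) (hF : HasFatouProperty ι) (hU : SatisfiesUpperTwoEstimate ι)
    {D : ℕ → I → ℝ} {M : ℝ} (hD : ∀ n, NormLE ι (D n) M)
    (hlim : ∀ δ : ℝ, 0 < δ → Tendsto (fun n => volume {u | δ ≤ |D n u|}) atTop (𝓝 0)) :
    ∃ (ψ : ℕ → ℕ) (C : ℝ), StrictMono ψ ∧ ∀ τ : ℕ → ℕ, StrictMono τ → ∀ m : ℕ, 1 ≤ m →
      NormLE ι (fun u => ∑ k ∈ Finset.range m, D (ψ (τ k)) u) (C * Real.sqrt m) := by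
  obtain ⟨c₁, h1⟩ := exists_normLE_one hE hF
  obtain ⟨C₂, -, hdisj⟩ := NormLE.exists_sum_of_disjoint hU
  obtain ⟨ψ, A, hψ, hAm, hsmall, htail⟩ := exists_subseq_almost_disjoint hE hF hD hlim
  have hc₁ := h1.nonneg
  set B : ℕ → Set I := fun i => ⋃ k, A (i + 1 + k) with hB
  have hBm : ∀ i, NullMeasurableSet (B i) volume := fun i => NullMeasurableSet.iUnion fun k => hAm _
  -- Three pieces: `w` is uniformly small, `e` lives on later sets and is small in norm, and the `s
  -- i` are pairwise disjoint. The first two have summable norms.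
  set w : ℕ → I → ℝ := fun i => (A i)ᶜ.indicator (D (ψ i)) with hw
  set e : ℕ → I → ℝ := fun i => (A i ∩ B i).indicator (D (ψ i)) with he
  set s : ℕ → I → ℝ := fun i => (A i \ B i).indicator (D (ψ i)) with hs
  have hwN : ∀ i, NormLE ι (w i) ((1 / 2) ^ i * c₁) := by
    intro i
    have h2 := h1.const_mul ((1 / 2) ^ i)
    rw [abs_of_pos (by positivity)] at h2
    refine h2.of_abs_le hE ((hD _).aestronglyMeasurable.indicator₀ (hAm i).compl)
      (ae_of_all _ fun u => ?_)
    rw [mul_one, abs_of_pos (a := (1 / 2 : ℝ) ^ i) (by positivity)]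
    by_cases hu : u ∈ A i
    · simp [hw, hu]
    · simp only [hw]
      rw [Set.indicator_of_mem (by exact hu)]
      exact hsmall i u hu
  have heN : ∀ i, NormLE ι (e i) ((1 / 2) ^ i) := fun i =>
    (htail i).indicator_mono hE Set.inter_subset_right ((hAm i).inter (hBm i))
  have hsN : ∀ i, NormLE ι (s i) M := fun i => (hD _).indicator hE ((hAm i).diff (hBm i))
  have hdec : ∀ i u, D (ψ i) u = w i u + e i u + s i u := by
    intro i u
    by_cases hA : u ∈ A i <;> by_cases hB : u ∈ B i <;> simp [hw, he, hs, hA, hB]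
  have hss : ∀ i j, i ≠ j → ∀ u, s i u = 0 ∨ s j u = 0 := by
    have key : ∀ i j, i < j → ∀ u, s i u = 0 ∨ s j u = 0 := by
      intro i j hij u
      by_cases hu : u ∈ A j
      · left
        refine Set.indicator_of_notMem (fun h => h.2 ?_) _
        refine Set.mem_iUnion.2 ⟨j - (i + 1), ?_⟩
        rwa [show i + 1 + (j - (i + 1)) = j by omega]
      · right
        exact Set.indicator_of_notMem (fun h => hu h.1) _
    intro i j hij u
    rcases lt_or_gt_of_ne hij with h | h
    · exact key i j h u
    · exact (key j i h u).symm
  refine ⟨ψ, 2 * c₁ + 2 + C₂ * M, hψ, fun τ hτ m hm => ?_⟩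
  have hsq : 1 ≤ Real.sqrt m := Real.one_le_sqrt.2 (by exact_mod_cast hm)
  have hsum := ((NormLE.sum (s := Finset.range m) fun k _ => hwN (τ k)).add
    (NormLE.sum (s := Finset.range m) fun k _ => heN (τ k))).add
    (hdisj (fun k => s (τ k)) M m (fun k => hsN (τ k))
      fun i j hij => ae_of_all _ (hss _ _ (hτ.injective.ne hij)))
  refine (hsum.mono ?_).congr (ae_of_all _ fun u => ?_)
  · rw [← Finset.sum_mul]
    have hp := sum_pow_strictMono_le hτ m
    have h2 : (∑ k ∈ Finset.range m, ((1 : ℝ) / 2) ^ τ k) * c₁ ≤ 2 * c₁ :=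
      mul_le_mul_of_nonneg_right hp hc₁
    nlinarith
  · simp only [hdec, Finset.sum_add_distrib]

end AlmostDisjoint

/-! ### Splitting of weakly null sequences and comparison of the index sets. -/

section BanachSaks

open ProbabilityTheory unitInterval

variable {E : Type*} [NormedAddCommGroup E] [NormedSpace ℝ E]
variable {ι : E →ₗ[ℝ] MeasFun01}

lemma IsWeaklyNull.exists_norm_le {x : ℕ → E} (hx : IsWeaklyNull x) : ∃ M, ∀ n, ‖x n‖ ≤ M := by
  obtain ⟨M, hM⟩ := banach_steinhaus (g := fun n => NormedSpace.inclusionInDoubleDual ℝ E (x n))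
    fun φ => by
      obtain ⟨C, hC⟩ := (hx φ).norm.bddAbove_range
      exact ⟨C, fun n => hC ⟨n, rfl⟩⟩
  refine ⟨M, fun n => ?_⟩
  rw [← (NormedSpace.inclusionInDoubleDualLi ℝ (E := E)).norm_map (x n)]
  exact hM n

/-- Integration is a bounded functional, by the embedding into `L¹`. -/
lemma IsWeaklyNull.tendsto_integral [Nontrivial E] (hE : IsRISpace ι) (hF : HasFatouProperty ι)
    {x : ℕ → E} (hx : IsWeaklyNull x) : Tendsto (fun n => ∫ u, ι (x n) u) atTop (𝓝 0) := by
  obtain ⟨K, -, hK⟩ := exists_integral_abs_le hE hF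
  have hi : ∀ z, Integrable (ι z) volume := fun z => (hK _ _ (normLE_coe ι z)).1
  let L : E →ₗ[ℝ] ℝ :=
    { toFun := fun z => ∫ u, ι z u
      map_add' := fun y z => by
        rw [← integral_add (hi y) (hi z), map_add]
        exact integral_congr_ae (AEEqFun.coeFn_add _ _)
      map_smul' := fun a z => by
        rw [RingHom.id_apply, smul_eq_mul, ← integral_const_mul, map_smul]
        exact integral_congr_ae (AEEqFun.coeFn_smul _ _) }
  refine hx (L.mkContinuous K fun z => ?_)
  exact (abs_integral_le_integral_abs).trans (hK _ _ (normLE_coe ι z)).2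

lemma identDistrib_sum {X Y : ℕ → I → ℝ} (h : ∀ n, IdentDistrib (X n) (Y n) volume volume)
    (hX : iIndepFun X volume) (hY : iIndepFun Y volume) (m : ℕ) :
    IdentDistrib (fun u => ∑ k ∈ Finset.range m, X k u) (fun u => ∑ k ∈ Finset.range m, Y k u)
      volume volume :=
  (IdentDistrib.pi h hX hY).comp (u := fun y : ℕ → ℝ => ∑ k ∈ Finset.range m, y k) (by fun_prop)

/-- A weakly null sequence of independent functions has a subsequence which splits, up to
equidistribution, into independent copies of one mean zero function and a part with partial
sums of order `√m`. -/
lemma exists_splitting [TopologicalSpace.SeparableSpace E] [Nontrivial E]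
    (hE : IsRISpace ι) (hF : HasFatouProperty ι) (hU2 : SatisfiesUpperTwoEstimate ι) {x : ℕ → E}
    (hx : IsWeaklyNull x) :
    ∃ (φ : ℕ → ℕ) (U : ℕ → I → I) (q : ℕ → I → ℝ) (q₀ : I → ℝ) (M C : ℝ),
      StrictMono φ ∧ IsUniformSeq U ∧
      (∀ n, IdentDistrib (q n) (ι (x (φ n))) volume volume) ∧
      NormLE ι q₀ M ∧ ∫ u, q₀ u = 0 ∧
      ∀ τ : ℕ → ℕ, StrictMono τ → ∀ m : ℕ, 1 ≤ m →
        NormLE ι (fun u => ∑ k ∈ Finset.range m, (q (τ k) (U (τ k) u) - q₀ (U (τ k) u)))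
          (C * Real.sqrt m) := by
  obtain ⟨M, hM⟩ := hx.exists_norm_le
  obtain ⟨K, hK0, hK⟩ := exists_integral_abs_le hE hF
  obtain ⟨U, hU⟩ := exists_isUniformSeq
  have hxN : ∀ n, NormLE ι (ι (x n)) M := fun n => (normLE_coe ι (x n)).mono (hM n)
  obtain ⟨φ, q, q₀, hφ, hq, hlim⟩ := exists_identDistrib_tendsto
    (fun n => (hK _ _ (hxN n)).1) fun n => (hK _ _ (hxN n)).2
  have hqN : ∀ n, NormLE ι (q n) M := fun n => (hxN (φ n)).of_identDistrib hE (hq n)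
  have hq₀N : NormLE ι q₀ M := NormLE.of_tendsto hF hqN hlim
  set d : ℕ → I → ℝ := fun n u => q n u - q₀ u with hd
  have hdN : ∀ n, NormLE ι (d n) (M + M) := fun n => (hqN n).sub hq₀N
  have hdU : ∀ n, IdentDistrib (fun u => d n (U n u)) (d n) volume volume := fun n =>
    hU.identDistrib (hdN n).aemeasurable n
  have hdlim : ∀ᵐ u, Tendsto (fun n => d n u) atTop (𝓝 0) := by
    filter_upwards [hlim] with u hu
    have := hu.sub_const (q₀ u)
    rwa [sub_self] at this
  have hmeas : ∀ δ : ℝ, 0 < δ →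
      Tendsto (fun n => volume {u | δ ≤ |d n (U n u)|}) atTop (𝓝 0) := by
    intro δ hδ
    have h1 := tendstoInMeasure_of_tendsto_ae (fun n => (hdN n).aestronglyMeasurable) hdlim
      (ENNReal.ofReal δ) (ENNReal.ofReal_pos.2 hδ)
    refine h1.congr fun n => ?_
    have h2 : {u | ENNReal.ofReal δ ≤ edist (d n u) 0} = d n ⁻¹' {r | δ ≤ |r|} := by
      ext u
      simp only [Set.mem_ofPred_eq, Set.mem_preimage]
      rw [edist_dist, ENNReal.ofReal_le_ofReal_iff dist_nonneg, Real.dist_eq, sub_zero]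
    rw [h2]
    exact ((hdU n).measure_mem_eq (measurableSet_le measurable_const measurable_id.abs)).symm
  obtain ⟨ψ, C, hψ, hC⟩ := exists_subseq_sum_le_sqrt hE hF hU2
    (fun n => (hdN n).of_identDistrib hE (hdU n)) hmeas
  refine ⟨φ ∘ ψ, U ∘ ψ, q ∘ ψ, q₀, M, C, hφ.comp hψ, hU.precomp hψ.injective, fun n => hq _, hq₀N,
    ?_, hC⟩
  have hint : ∀ n, ∫ u, d n (U n u) = (∫ u, ι (x (φ n)) u) - ∫ u, q₀ u := fun n => by
    rw [(hdU n).integral_eq, ← (hq n).integral_eq]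
    exact integral_sub (hK _ _ (hqN n)).1 (hK _ _ hq₀N).1
  have hlim1 : Tendsto (fun n => ∫ u, d (ψ n) (U (ψ n) u)) atTop (𝓝 (0 - ∫ u, q₀ u)) := by
    simp only [hint]
    exact ((hx.tendsto_integral hE hF).comp (hφ.comp hψ).tendsto_atTop).sub_const _
  -- The Cesàro means of the remainder's integrals tend to `-∫ q₀`, yet the `√m` bound on its sums
  -- makes them `O(m^(-1/2))`. So `q₀` has mean zero.
  have hces := hlim1.cesaro
  have hzero : Tendsto (fun m : ℕ => (m : ℝ)⁻¹ *
      ∑ k ∈ Finset.range m, ∫ u, d (ψ k) (U (ψ k) u)) atTop (𝓝 0) := by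
    have hb : Tendsto (fun m : ℕ => K * C * (m : ℝ) ^ (-(1 / 2) : ℝ)) atTop (𝓝 0) := by
      have := ((tendsto_rpow_neg_atTop (show (0 : ℝ) < 1 / 2 by norm_num)).comp
        tendsto_natCast_atTop_atTop).const_mul (K * C)
      rwa [mul_zero] at this
    refine squeeze_zero_norm' ?_ hb
    filter_upwards [eventually_ge_atTop 1] with m hm
    have hm0 : (0 : ℝ) < m := by exact_mod_cast hm
    have hsq : 0 < Real.sqrt m := Real.sqrt_pos.2 hm0
    have h1 : |∑ k ∈ Finset.range m, ∫ u, d (ψ k) (U (ψ k) u)| ≤ K * (C * Real.sqrt m) := by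
      rw [← integral_finsetSum _ fun k _ =>
        (hK _ _ ((hdN (ψ k)).of_identDistrib hE (hdU (ψ k)))).1]
      exact abs_integral_le_integral_abs.trans (hK _ _ (hC id strictMono_id m hm)).2
    rw [norm_mul, norm_inv, Real.norm_eq_abs, Real.norm_eq_abs, Nat.abs_cast,
      Real.rpow_neg hm0.le, ← Real.sqrt_eq_rpow]
    calc (m : ℝ)⁻¹ * |∑ k ∈ Finset.range m, ∫ u, d (ψ k) (U (ψ k) u)|
        ≤ (m : ℝ)⁻¹ * (K * (C * Real.sqrt m)) := by gcongr
      _ = K * C * (Real.sqrt m)⁻¹ := by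
          field_simp
          rw [Real.sq_sqrt hm0.le]
          ring
  have := tendsto_nhds_unique hces hzero
  linarith

lemma mem_gammaI_of_mem_gammaIID [TopologicalSpace.SeparableSpace E] [Nontrivial E]
    (hE : IsRISpace ι) (hF : HasFatouProperty ι) (hU2 : SatisfiesUpperTwoEstimate ι) {p : ℝ}
    (hp : p ∈ gammaIID ι) : p ∈ gammaI ι := by
  have hp2 := le_two_of_mem_gammaIID hE hF hp
  have hp1 : 1 ≤ p := hp.1
  refine ⟨hp1, fun x hx hind => ?_⟩
  obtain ⟨φ, U, q, q₀, M, C, hφ, hU, hq, hq₀N, hq₀, hC⟩ := exists_splitting hE hF hU2 hx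
  obtain ⟨g, hg, hgw, hgi, hgd⟩ := exists_iid_copies hE hF hU hq₀N hq₀
  obtain ⟨τ, hτ, -, hbs⟩ := hp.2 g hgw ⟨hgi, hgd⟩
  obtain ⟨M', hM'⟩ := hx.exists_norm_le
  refine ⟨φ ∘ τ, hφ.comp hτ, ⟨M', by rintro _ ⟨n, rfl⟩; exact hM' _⟩, fun ρ hρ => ?_⟩
  obtain ⟨C₁, hC₁⟩ := hbs ρ hρ
  refine ⟨C₁ + |C|, fun m hm => ?_⟩
  have hm1 : (1 : ℝ) ≤ m := by exact_mod_cast hm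
  have hm0 : (0 : ℝ) < m := by linarith
  have hτρ : StrictMono (τ ∘ ρ) := hτ.comp hρ
  have hg' : NormLE ι (fun u => ∑ k ∈ Finset.range m, q₀ (U (τ (ρ k)) u))
      (C₁ * (m : ℝ) ^ (1 / p)) := by
    have h1 := hC₁ m hm
    rw [Real.rpow_neg hm0.le, inv_mul_eq_div, div_le_iff₀ (by positivity)] at h1
    refine ((normLE_coe ι _).mono h1).congr ?_
    filter_upwards [coeFn_sum_ae ι (fun k => (g ∘ τ) (ρ k)) (Finset.range m),
      ae_all_iff.2 fun k => hg k] with u h1 h2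
    rw [h1]
    exact Finset.sum_congr rfl fun k _ => h2 _
  have hsqrt : Real.sqrt m ≤ (m : ℝ) ^ (1 / p) := by
    rw [Real.sqrt_eq_rpow]
    exact Real.rpow_le_rpow_of_exponent_le hm1 (one_div_le_one_div_of_le (by linarith) hp2)
  have hY := (hg'.add (hC _ hτρ m hm)).congr
    (g := fun u => ∑ k ∈ Finset.range m, q (τ (ρ k)) (U (τ (ρ k)) u))
    (ae_of_all _ fun u => by
      simp only [Function.comp_apply]
      rw [← Finset.sum_add_distrib]
      exact Finset.sum_congr rfl fun k _ => by ring)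
  have hX := hY.of_identDistrib hE (identDistrib_sum
    (X := fun k => ι (x (φ (τ (ρ k))))) (Y := fun k u => q (τ (ρ k)) (U (τ (ρ k)) u))
    (fun k => (hq _).symm.trans (hU.identDistrib (hq _).aemeasurable_fst _).symm)
    (iIndepFun.precomp (g := φ ∘ (τ ∘ ρ)) (hφ.comp hτρ).injective hind)
    ((hU.precomp hτρ.injective).comp_indep fun k => (hq _).aemeasurable_fst) m)
  have hnorm := norm_le_of_normLE hE (hX.congr
    (coeFn_sum_ae ι (fun k => x (φ (τ (ρ k)))) (Finset.range m)).symm)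
  rw [Real.rpow_neg hm0.le, inv_mul_eq_div, div_le_iff₀ (by positivity), add_mul]
  refine hnorm.trans (add_le_add le_rfl ?_)
  exact (mul_le_mul_of_nonneg_right (le_abs_self C) (Real.sqrt_nonneg _)).trans
    (mul_le_mul_of_nonneg_left hsqrt (abs_nonneg C))

end BanachSaks

theorem mainTheorem12 {E : Type*} [NormedAddCommGroup E] [NormedSpace ℝ E]
    [TopologicalSpace.SeparableSpace E] (ι : E →ₗ[ℝ] MeasFun01) (hE : IsRISpace ι)
    (hFatou : HasFatouProperty ι) (hUpper : SatisfiesUpperTwoEstimate ι) :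
    gammaIID ι = gammaI ι := by
  refine Set.Subset.antisymm (fun p hp => ?_) fun p hp => ⟨hp.1, fun x hx h => hp.2 x hx h.1⟩
  -- The zero space is separate because `p ≤ 2` fails there: every `p ≥ 1` belongs to both sets.
  rcases subsingleton_or_nontrivial E with hs | hn
  · refine ⟨hp.1, fun x _ _ => ⟨id, strictMono_id, ⟨0, ?_⟩, fun σ _ => ⟨0, fun m _ => ?_⟩⟩⟩
    · rintro _ ⟨n, rfl⟩
      simp [Subsingleton.elim (x n) 0]
    · rw [Subsingleton.elim (∑ k ∈ Finset.range m, (x ∘ id) (σ k)) 0]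
      simp
  · exact mem_gammaI_of_mem_gammaIID hE hFatou hUpper hp
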